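/- **Lemma ($\Delta$-Gapped $k$-Distinctness).** For integers $m\ge 1$, $1\le k\le n$ and a real gap $0<\Delta\le k$, the *$\Delta$-Gapped $k$-Distinctness* problem is the following: given oracle access to an array $A$ of length $n$ with entries in $\{0,\dots,m-1\}$, decide whether there are $k$ distinct indices at which $A$ takes the same value, under the promise that either this is the case or no value appears more than $k-\Delta$ times in $A$. A quantum query algorithm on $q$ qubits starts in $|0^q\rangle$ and applies $U_0,O_A,U_1,O_A,\dots,O_A,U_T$, where the unitaries $U_j$ on all $q$ qubits do not depend on $A$ and $O_A$ is the array oracle $|i\rangle|y\rangle|z\rangle\mapsto|i\rangle|y\oplus A_i\rangle|z\rangle$ (an index register of $\lceil\log_2 n\rceil$ qubits, a value register of $\lceil\log_2 m\rceil$ qubits and work qubits, all counted in $q$; basis states with $i\ge n$ are left unchanged); it then measures all qubits in the standard basis and answers according to the outcome. $T$ is its number of queries. There are absolute constants $C>0$ and $c\in\mathbb N$ such that for all integers $m\ge1$, $1\le k\le n$ and all reals $0<\Delta\le k$ and $0<\delta<\tfrac12$ there is a quantum query algorithm that answers correctly with probability at least $1-\delta$ on every array satisfying the promise, and that makes at most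 $$C\,\frac{n^{3/2}}{\Delta\sqrt k}\,\Big(\log\frac{n}{\delta k}\Big)^{c}$$ queries, that is $\tilde O\big(\tfrac{n^{3/2}}{\Delta\sqrt k}\big)$, and uses at most $$C\,(\log m+\log n)\,\log\frac{n}{\delta k}$$ qubits. -/

import Mathlib

/-- The computational basis of the `⌈log₂ n⌉ + ⌈log₂ m⌉ + w` qubits of a query algorithm for
`n`-sized `m`-valued arrays: an index register, a value register and `w` work qubits. -/
abbrev QBasis (n m w : ℕ) : Type :=
  BitVec (Nat.clog 2 n) × BitVec (Nat.clog 2 m) × BitVec w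

instance instFintypeBitVecReg (l : ℕ) : Fintype (BitVec l) :=
  Fintype.ofEquiv (Fin (2 ^ l)) ⟨BitVec.ofFin, BitVec.toFin, fun _ => rfl, fun _ => rfl⟩

/-- The action of the array oracle on basis states: `|i⟩|y⟩|z⟩ ↦ |i⟩|y ⊕ A i⟩|z⟩`, where `⊕` is
bitwise XOR; basis states whose index register does not hold an index of the array are fixed. -/
def oracleMap {n m : ℕ} (w : ℕ) (A : Fin n → Fin m) (s : QBasis n m w) : QBasis n m w :=
  if h : s.1.toNat < n then
    (s.1, s.2.1 ^^^ BitVec.ofNat (Nat.clog 2 m) (A ⟨s.1.toNat, h⟩).val, s.2.2)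
  else s

/-- The matrix of the array oracle: it sends the basis vector `|t⟩` to `|oracleMap w A t⟩`. -/
def oracleMatrix {n m : ℕ} (w : ℕ) (A : Fin n → Fin m) :
    Matrix (QBasis n m w) (QBasis n m w) ℂ :=
  Matrix.of fun s t => if s = oracleMap w A t then 1 else 0

/-- A quantum query algorithm for `n`-sized `m`-valued arrays. It starts in the all-zero basis
state, applies `U 0`, then alternately the array oracle and `U 1, …, U numQueries` (unitaries that
do not depend on the array), measures all qubits in the standard basis and answers "yes" exactly
if the outcome lies in `accept`. Only the first `numQueries + 1` entries of `U` are used. -/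
structure QueryAlgorithm (n m : ℕ) where
  workQubits : ℕ
  numQueries : ℕ
  U : ℕ → Matrix.unitaryGroup (QBasis n m workQubits) ℂ
  accept : Finset (QBasis n m workQubits)

namespace QueryAlgorithm

/-- Total number of qubits, those of the index and value registers included. -/
def numQubits {n m : ℕ} (alg : QueryAlgorithm n m) : ℕ :=
  Nat.clog 2 n + Nat.clog 2 m + alg.workQubits

/-- The state `U_t O_A U_{t-1} ⋯ O_A U_0 |0⟩` reached after `t` queries to the array `A`. -/
noncomputable def state {n m : ℕ} (alg : QueryAlgorithm n m) (A : Fin n → Fin m) :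
    ℕ → QBasis n m alg.workQubits → ℂ
  | 0 => Matrix.mulVec (alg.U 0).val (Pi.single 0 1)
  | t + 1 => Matrix.mulVec (alg.U (t + 1)).val
      (Matrix.mulVec (oracleMatrix alg.workQubits A) (state alg A t))

/-- The probability that the algorithm answers "yes" on the array `A`. -/
noncomputable def acceptProb {n m : ℕ} (alg : QueryAlgorithm n m) (A : Fin n → Fin m) : ℝ :=
  ∑ s ∈ alg.accept, ‖alg.state A alg.numQueries s‖ ^ 2

end QueryAlgorithm

/-- `A` has `k` distinct indices with identical values. -/
def HasKEqual {n m : ℕ} (k : ℕ) (A : Fin n → Fin m) : Prop :=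
  ∃ S : Finset (Fin n), S.card = k ∧ ∀ i ∈ S, ∀ j ∈ S, A i = A j

/-- No value appears more than `k - Δ` times in `A`. -/
def AllFreqLE {n m : ℕ} (k : ℕ) (Δ : ℝ) (A : Fin n → Fin m) : Prop :=
  ∀ v : Fin m, ((Finset.univ.filter fun i => A i = v).card : ℝ) ≤ (k : ℝ) - Δ

/-- The algorithm solves `Δ`-Gapped `k`-Distinctness with error at most `δ`: on every array that
satisfies the promise, its answer is correct with probability at least `1 - δ`. -/
def SolvesGappedKDistinctness {n m : ℕ} (alg : QueryAlgorithm n m) (k : ℕ) (Δ δ : ℝ) : Prop :=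
  ∀ A : Fin n → Fin m,
    (HasKEqual k A → 1 - δ ≤ alg.acceptProb A) ∧
    (AllFreqLE k Δ A → 1 - δ ≤ 1 - alg.acceptProb A)

/-! A uniformly random index is drawn in superposition and its value is queried. Conditioned on the
value `v`, occurring `h` times, the register holds the uniform superposition of the hits of `v`,
which lies in the plane of the Grover walk for `v`. The eigenphases `±ω` of the walk there satisfy
`|1 - exp (iω)| = 2√(h/n)`, so phase estimation separates `h ≥ k` from `h ≤ k - Δ` once its
precision is about `Δ/√(kn)`, that is with `O(√(kn)/Δ)` walk steps up to logarithms. In a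
yes-instance a frequent value is drawn with probability at least `k/n`, so about `(n/k) log (1/δ)`
rounds find one, and the product of the two costs is `n^{3/2}/(Δ√k)`.

Saving qubits needs two devices. The clock amplitudes are an `(r+1)`-fold convolution of a box of
length `N`; its tails fall below `2^{-r}` (`sum_norm_sq_phaseState_le`), so one clock of logarithmic
size replaces a vote among many. Rounds reuse the same registers: estimation is run, a counter is
raised on a high outcome, estimation is undone, and the counter is raised again if the initial state
is not recovered. If `p` is the probability of a high outcome, the branch with counter zero keeps
amplitude exactly `1 - p` per round (`CounterSlice.testRound`), so the algorithm rejects with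
probability `(1 - p)^{2R}` after `R` rounds.

Frequencies are integers, so `Δ` may be replaced by `max Δ 1`; this keeps the clock size polynomial
in `n` and `log (n/(δk))`. `exists_solves` gives correctness, `exists_parameters` the bounds. -/

open Polynomial

/-! ### Fourier sums over `ZMod M` -/

theorem sum_zmod_val {M : ℕ} [NeZero M] {E : Type*} [AddCommMonoid E] (f : ℕ → E) :
    ∑ j : ZMod M, f j.val = ∑ i ∈ Finset.range M, f i := by
  refine Finset.sum_nbij' (fun j => j.val) (fun i => (i : ZMod M)) ?_ ?_ ?_ ?_ ?_
  · intro j _; exact Finset.mem_range.2 (ZMod.val_lt j)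
  · intro i _; exact Finset.mem_univ _
  · intro j _; exact ZMod.natCast_zmod_val j
  · intro i hi; exact ZMod.val_cast_of_lt (Finset.mem_range.1 hi)
  · intro j _; rfl

theorem stdAddChar_mul_eq_pow {M : ℕ} [NeZero M] (y j : ZMod M) :
    ZMod.stdAddChar (y * j) = (ZMod.stdAddChar y : ℂ) ^ j.val := by
  rw [← AddChar.map_nsmul_eq_pow, nsmul_eq_mul, ZMod.natCast_zmod_val, mul_comm]

theorem sum_conj_stdAddChar {M : ℕ} [NeZero M] (j j' : ZMod M) :
    ∑ y : ZMod M, (starRingEnd ℂ) (ZMod.stdAddChar (y * j)) * ZMod.stdAddChar (y * j') =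
      if j = j' then (M : ℂ) else 0 := by
  have h := AddChar.sum_mulShift (R' := ℂ) (j' - j) (ZMod.isPrimitive_stdAddChar M)
  rw [ZMod.card] at h
  have e : ∀ y : ZMod M, (starRingEnd ℂ) (ZMod.stdAddChar (y * j)) * ZMod.stdAddChar (y * j') =
      ZMod.stdAddChar (y * (j' - j)) := by
    intro y
    rw [← AddChar.map_neg_eq_conj, ← AddChar.map_add_eq_mul]
    congr 1; ring
  rw [Finset.sum_congr rfl fun y _ => e y, h]
  by_cases hj : j = j'
  · simp [hj]
  · simp [hj, sub_eq_zero, Ne.symm hj]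

/-- Parseval's identity for the unnormalized vector-valued discrete Fourier transform. -/
theorem sum_norm_sq_dft {M : ℕ} [NeZero M] {E : Type*} [NormedAddCommGroup E]
    [InnerProductSpace ℂ E] (x : ZMod M → E) :
    ∑ y : ZMod M, ‖∑ j, (ZMod.stdAddChar (y * j) : ℂ) • x j‖ ^ 2 = M * ∑ j, ‖x j‖ ^ 2 := by
  have h : (∑ y : ZMod M, inner ℂ (∑ j, (ZMod.stdAddChar (y * j) : ℂ) • x j)
      (∑ j, (ZMod.stdAddChar (y * j) : ℂ) • x j)) = (M : ℂ) * ∑ j, inner ℂ (x j) (x j) := by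
    simp only [inner_sum, inner_smul_right, sum_inner, inner_smul_left, Finset.mul_sum]
    rw [Finset.sum_comm]
    refine Finset.sum_congr rfl fun j _ => ?_
    rw [Finset.sum_comm]
    calc _ = ∑ j', (∑ y : ZMod M, (starRingEnd ℂ) (ZMod.stdAddChar (y * j')) *
          ZMod.stdAddChar (y * j)) * inner ℂ (x j') (x j) := by
            refine Finset.sum_congr rfl fun j' _ => ?_
            rw [Finset.sum_mul]
            refine Finset.sum_congr rfl fun y _ => ?_
            ring
      _ = _ := by
            simp only [sum_conj_stdAddChar, ite_mul, zero_mul, Finset.sum_ite_eq',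
              Finset.mem_univ, if_true]
  simp only [inner_self_eq_norm_sq_to_K] at h
  apply Complex.ofReal_injective
  push_cast
  exact h

/-! ### The box-spline window and its norm -/

/-- The box-spline window: the polynomial `(1 + X + ⋯ + X ^ (N - 1)) ^ (r + 1)`. -/
noncomputable def boxSpline (N r : ℕ) : ℂ[X] := (∑ i ∈ Finset.range N, X ^ i) ^ (r + 1)

theorem natDegree_boxSpline_lt {N r M : ℕ} (hN : 0 < N) (hM : (r + 1) * N ≤ M) :
    (boxSpline N r).natDegree < M := by
  have h1 : (∑ i ∈ Finset.range N, (X : ℂ[X]) ^ i).natDegree ≤ N - 1 := by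
    refine natDegree_sum_le_of_forall_le _ _ fun i hi => ?_
    rw [natDegree_X_pow]
    have := Finset.mem_range.1 hi
    omega
  have h2 : (boxSpline N r).natDegree ≤ (r + 1) * (N - 1) :=
    natDegree_pow_le.trans (Nat.mul_le_mul_left _ h1)
  refine h2.trans_lt (lt_of_lt_of_le ?_ hM)
  exact Nat.mul_lt_mul_of_pos_left (by omega) (by omega)

/-- The square of the `ℓ²` norm of the coefficients of the box spline. -/
noncomputable def boxSplineNormSq (N r : ℕ) : ℝ :=
  ∑ i ∈ Finset.range ((r + 1) * N), ‖(boxSpline N r).coeff i‖ ^ 2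

/-- The coefficients add up to the value `N^{r+1}` at `1`; Cauchy–Schwarz over the at most `(r+1)N`
nonzero ones gives the bound. -/
theorem boxSpline_norm_lower {N r : ℕ} (hN : 0 < N) :
    (N : ℝ) ^ (2 * r + 1) ≤ (r + 1) * boxSplineNormSq N r := by
  have h1 : (boxSpline N r).eval 1 = (N : ℂ) ^ (r + 1) := by
    simp [boxSpline, eval_finsetSum]
  rw [eval_eq_sum_range' (natDegree_boxSpline_lt hN le_rfl)] at h1
  simp only [one_pow, mul_one] at h1
  have h2 : ((N : ℝ) ^ (r + 1)) ^ 2 ≤ ((r + 1) * N : ℕ) * boxSplineNormSq N r := by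
    have h3 : (N : ℝ) ^ (r + 1) ≤ ∑ i ∈ Finset.range ((r + 1) * N), ‖(boxSpline N r).coeff i‖ := by
      have := norm_sum_le (Finset.range ((r + 1) * N)) (fun i => (boxSpline N r).coeff i)
      rw [h1] at this
      simpa using this
    calc ((N : ℝ) ^ (r + 1)) ^ 2 ≤ (∑ i ∈ Finset.range ((r + 1) * N), ‖(boxSpline N r).coeff i‖) ^ 2 := by
          gcongr
      _ ≤ _ := by
          have := sq_sum_le_card_mul_sum_sq (s := Finset.range ((r + 1) * N))
            (f := fun i => ‖(boxSpline N r).coeff i‖)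
          rwa [Finset.card_range] at this
  have hN' : (0 : ℝ) < N := by exact_mod_cast hN
  refine le_of_mul_le_mul_left ?_ hN'
  calc (N : ℝ) * N ^ (2 * r + 1) = ((N : ℝ) ^ (r + 1)) ^ 2 := by ring
    _ ≤ _ := h2
    _ = _ := by push_cast; ring

theorem boxSplineNormSq_pos {N r : ℕ} (hN : 0 < N) : 0 < boxSplineNormSq N r := by
  have h := boxSpline_norm_lower (r := r) hN
  have hN' : (0 : ℝ) < N ^ (2 * r + 1) := by positivity
  by_contra hc
  push Not at hc
  have : ((r : ℝ) + 1) * boxSplineNormSq N r ≤ 0 := mul_nonpos_of_nonneg_of_nonpos (by positivity) hc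
  linarith

/-- Amplitude of the clock state at position `j`. -/
noncomputable def clockAmp (N r j : ℕ) : ℂ :=
  (((√(boxSplineNormSq N r))⁻¹ : ℝ) : ℂ) * (boxSpline N r).coeff j

theorem sum_norm_sq_clockAmp {N r M : ℕ} [NeZero M] (hN : 0 < N) (hM : (r + 1) * N ≤ M) :
    ∑ j : ZMod M, ‖clockAmp N r j.val‖ ^ 2 = 1 := by
  rw [sum_zmod_val (fun i => ‖clockAmp N r i‖ ^ 2)]
  have h : ∀ i ∈ Finset.range M, i ∉ Finset.range ((r + 1) * N) → ‖clockAmp N r i‖ ^ 2 = 0 := by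
    intro i _ hi
    have : (boxSpline N r).coeff i = 0 :=
      coeff_eq_zero_of_natDegree_lt ((natDegree_boxSpline_lt hN le_rfl).trans_le
        (by simpa using hi))
    simp [clockAmp, this]
  rw [← Finset.sum_subset (Finset.range_subset_range.2 hM) h]
  have hp := boxSplineNormSq_pos (r := r) hN
  simp only [clockAmp, norm_mul, mul_pow, ← Finset.mul_sum]
  rw [Complex.norm_real, ← boxSplineNormSq]
  simp only [norm_inv, Real.norm_eq_abs, inv_pow, sq_abs]
  rw [Real.sq_sqrt hp.le, inv_mul_cancel₀ hp.ne']

/-! ### Phase estimation with the box-spline window -/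

section Walk

variable {E : Type*} [NormedAddCommGroup E] [InnerProductSpace ℂ E]

theorem aeval_smul_isometry_apply (G : E ≃ₗᵢ[ℂ] E) (z : ℂ) (p : ℂ[X]) {M : ℕ}
    (hp : p.natDegree < M) (x : E) :
    aeval (z • (G.toLinearEquiv : E →ₗ[ℂ] E)) p x =
      ∑ i ∈ Finset.range M, z ^ i • p.coeff i • (G ^ i) x := by
  rw [aeval_eq_sum_range' hp]
  simp only [LinearMap.sum_apply, LinearMap.smul_apply]
  refine Finset.sum_congr rfl fun i hi => ?_
  rw [smul_comm]
  congr 1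
  clear hi
  induction i generalizing x with
  | zero => simp
  | succ i ih =>
    rw [pow_succ, Module.End.mul_apply, ih, pow_succ, pow_succ]
    simp [mul_smul]

/-- The hypothesis on `G x + G⁻¹ x` replaces a spectral decomposition: `x` is a sum of eigenvectors
with phases `±ω`, `2 cos ω = 2 - 4s`. Pairing with `x` gives the real part of `⟨x, G x⟩`. -/
theorem norm_one_sub_isometry_sq {G : E ≃ₗᵢ[ℂ] E} {s : ℝ} {x : E}
    (hx : G x + G⁻¹ x = ((2 - 4 * s : ℝ) : ℂ) • x) : ‖x - G x‖ ^ 2 = 4 * s * ‖x‖ ^ 2 := by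
  have h1 : inner ℂ x (G⁻¹ x) = inner ℂ (G x) x := by
    rw [← G.inner_map_map x (G⁻¹ x)]
    congr 1
    exact G.apply_symm_apply x
  have h2 : inner ℂ x (G x) + inner ℂ (G x) x = ((2 - 4 * s : ℝ) : ℂ) * inner ℂ x x := by
    rw [← h1, ← inner_add_right, hx, inner_smul_right]
  have h3 := congrArg Complex.re h2
  rw [Complex.add_re, inner_self_eq_norm_sq_to_K] at h3
  have h4 : (inner ℂ (G x) x).re = (inner ℂ x (G x)).re := by
    have := inner_re_symm (𝕜 := ℂ) (G x) x
    simpa using this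
  have h5 := norm_sub_sq (𝕜 := ℂ) x (G x)
  rw [G.norm_map] at h5
  rw [h4] at h3
  have h6 : ((((2 - 4 * s : ℝ) : ℂ)) * ((‖x‖ : ℂ)) ^ 2).re = (2 - 4 * s) * ‖x‖ ^ 2 := by
    norm_cast
  have h3' : (inner ℂ x (G x)).re + (inner ℂ x (G x)).re = (2 - 4 * s) * ‖x‖ ^ 2 := by
    rw [h3]; exact h6
  have h5' : ‖x - G x‖ ^ 2 = ‖x‖ ^ 2 - 2 * (inner ℂ x (G x)).re + ‖x‖ ^ 2 := h5
  linarith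

/-- Reverse triangle inequality for `x - z G x = (1 - z) x + z (x - G x)`, whose two terms have
norms `|1 - z| ‖x‖` and `2√s ‖x‖`. -/
theorem le_norm_sub_smul_isometry {G : E ≃ₗᵢ[ℂ] E} {s g : ℝ} (hs : 0 ≤ s) {z : ℂ} (hz : ‖z‖ = 1)
    (hg : g ≤ |‖1 - z‖ - 2 * √s|) {x : E}
    (hx : G x + G⁻¹ x = ((2 - 4 * s : ℝ) : ℂ) • x) : g * ‖x‖ ≤ ‖x - z • G x‖ := by
  have h1 : ‖x - G x‖ = 2 * √s * ‖x‖ := by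
    have := norm_one_sub_isometry_sq hx
    rw [← Real.sqrt_sq (norm_nonneg (x - G x)), this, Real.sqrt_mul (by positivity),
      Real.sqrt_mul (by positivity), Real.sqrt_sq (norm_nonneg x)]
    congr 2
    rw [show (4 : ℝ) = 2 ^ 2 by norm_num, Real.sqrt_sq (by norm_num)]
  have h2 : ‖(1 - z) • x‖ = ‖1 - z‖ * ‖x‖ := norm_smul _ _
  have h3 : x - z • G x = (1 - z) • x + z • (x - G x) := by
    rw [smul_sub, sub_smul, one_smul]; abel
  have h4 : ‖z • (x - G x)‖ = 2 * √s * ‖x‖ := by rw [norm_smul, hz, one_mul, h1]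
  have h5 : |‖(1 - z) • x‖ - ‖z • (x - G x)‖| ≤ ‖x - z • G x‖ := by
    rw [h3]
    have := abs_norm_sub_norm_le ((1 - z) • x) (-(z • (x - G x)))
    rwa [norm_neg, sub_neg_eq_add] at this
  rw [h2, h4, ← sub_mul, abs_mul, abs_of_nonneg (norm_nonneg x)] at h5
  exact (mul_le_mul_of_nonneg_right hg (norm_nonneg x)).trans h5

/-- Eigenvector-like vectors stay so under polynomials in the unitary. -/
theorem aeval_smul_isometry_mem {G : E ≃ₗᵢ[ℂ] E} {c : ℂ} (z : ℂ) (p : ℂ[X]) {x : E}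
    (hx : G x + G⁻¹ x = c • x) :
    G (aeval (z • (G.toLinearEquiv : E →ₗ[ℂ] E)) p x) +
      G⁻¹ (aeval (z • (G.toLinearEquiv : E →ₗ[ℂ] E)) p x) =
        c • aeval (z • (G.toLinearEquiv : E →ₗ[ℂ] E)) p x := by
  have hpow : ∀ i : ℕ, G ((G ^ i) x) + G⁻¹ ((G ^ i) x) = c • (G ^ i) x := by
    intro i
    have e1 : G ((G ^ i) x) = (G ^ i) (G x) := by
      change (G * G ^ i) x = (G ^ i * G) x
      rw [(Commute.self_pow G i).eq]
    have e2 : G⁻¹ ((G ^ i) x) = (G ^ i) (G⁻¹ x) := by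
      change (G⁻¹ * G ^ i) x = (G ^ i * G⁻¹) x
      rw [((Commute.refl G).inv_left.pow_right i).eq]
    rw [e1, e2, ← map_add, hx, map_smul]
  rw [aeval_smul_isometry_apply G z p (Nat.lt_succ_self _)]
  simp only [map_sum, map_smul]
  rw [← Finset.sum_add_distrib, Finset.smul_sum]
  refine Finset.sum_congr rfl fun i _ => ?_
  rw [← smul_add, ← smul_add, hpow, smul_comm c, smul_comm c]

theorem pow_mul_norm_le_aeval {G : E ≃ₗᵢ[ℂ] E} {s g : ℝ} (hs : 0 ≤ s) (hg0 : 0 ≤ g) {z : ℂ}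
    (hz : ‖z‖ = 1) (hg : g ≤ |‖1 - z‖ - 2 * √s|) (r : ℕ) {x : E}
    (hx : G x + G⁻¹ x = ((2 - 4 * s : ℝ) : ℂ) • x) :
    g ^ r * ‖x‖ ≤ ‖aeval (z • (G.toLinearEquiv : E →ₗ[ℂ] E)) ((1 - X) ^ r : ℂ[X]) x‖ := by
  induction r with
  | zero => simp
  | succ r ih =>
    rw [pow_succ' (1 - X : ℂ[X]), map_mul, Module.End.mul_apply]
    have h := le_norm_sub_smul_isometry hs hz hg
      (aeval_smul_isometry_mem (G := G) z ((1 - X) ^ r : ℂ[X]) hx)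
    have h2 : aeval (z • (G.toLinearEquiv : E →ₗ[ℂ] E)) (1 - X : ℂ[X]) =
      1 - z • (G.toLinearEquiv : E →ₗ[ℂ] E) := by simp
    rw [h2]
    calc g ^ (r + 1) * ‖x‖ = g * (g ^ r * ‖x‖) := by ring
      _ ≤ _ := mul_le_mul_of_nonneg_left ih hg0
      _ ≤ _ := h

theorem norm_aeval_one_sub_pow_le (G : E ≃ₗᵢ[ℂ] E) {z : ℂ} (hz : ‖z‖ = 1) (N r : ℕ) (x : E) :
    ‖aeval (z • (G.toLinearEquiv : E →ₗ[ℂ] E)) ((1 - X ^ N) ^ r : ℂ[X]) x‖ ≤ 2 ^ r * ‖x‖ := by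
  induction r with
  | zero => simp
  | succ r ih =>
    rw [pow_succ' (1 - X ^ N : ℂ[X]), map_mul, Module.End.mul_apply]
    set u := aeval (z • (G.toLinearEquiv : E →ₗ[ℂ] E)) ((1 - X ^ N) ^ r : ℂ[X]) x
    have h2 : ∀ (i : ℕ) (w : E), ‖((z • (G.toLinearEquiv : E →ₗ[ℂ] E)) ^ i) w‖ = ‖w‖ := by
      intro i
      induction i with
      | zero => simp
      | succ i ih => intro w; rw [pow_succ, Module.End.mul_apply, ih]; simp [norm_smul, hz]
    have h3 : aeval (z • (G.toLinearEquiv : E →ₗ[ℂ] E)) (1 - X ^ N : ℂ[X]) u =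
        u - ((z • (G.toLinearEquiv : E →ₗ[ℂ] E)) ^ N) u := by simp
    rw [h3]
    calc _ ≤ ‖u‖ + ‖((z • (G.toLinearEquiv : E →ₗ[ℂ] E)) ^ N) u‖ := norm_sub_le _ _
      _ = 2 * ‖u‖ := by rw [h2]; ring
      _ ≤ 2 * (2 ^ r * ‖x‖) := by gcongr
      _ = _ := by ring

/-- The clock state after the controlled powers of `G` and the (normalized) Fourier transform. -/
noncomputable def phaseState (M N r : ℕ) [NeZero M] (G : E ≃ₗᵢ[ℂ] E) (x : E) (y : ZMod M) : E :=
  (((√M)⁻¹ : ℝ) : ℂ) •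
    ∑ j : ZMod M, (ZMod.stdAddChar (y * j) : ℂ) • clockAmp N r j.val • (G ^ j.val) x

theorem sum_norm_sq_phaseState {M N r : ℕ} [NeZero M] (hN : 0 < N) (hM : (r + 1) * N ≤ M)
    (G : E ≃ₗᵢ[ℂ] E) (x : E) : ∑ y, ‖phaseState M N r G x y‖ ^ 2 = ‖x‖ ^ 2 := by
  have hM0 : (0 : ℝ) < M := by exact_mod_cast NeZero.pos M
  simp only [phaseState, norm_smul, mul_pow, ← Finset.mul_sum]
  rw [sum_norm_sq_dft]
  simp only [norm_smul, LinearIsometryEquiv.norm_map, mul_pow, ← Finset.sum_mul]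
  rw [sum_norm_sq_clockAmp hN hM, one_mul, Complex.norm_real, Real.norm_eq_abs, sq_abs, inv_pow,
    Real.sq_sqrt hM0.le, ← mul_assoc, inv_mul_cancel₀ hM0.ne', one_mul]

theorem norm_stdAddChar {M : ℕ} [NeZero M] (y : ZMod M) : ‖(ZMod.stdAddChar y : ℂ)‖ = 1 :=
  AddChar.norm_apply _ _

theorem phaseState_eq {M N r : ℕ} [NeZero M] (hN : 0 < N) (hM : (r + 1) * N ≤ M)
    (G : E ≃ₗᵢ[ℂ] E) (x : E) (y : ZMod M) : phaseState M N r G x y =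
      (((√M)⁻¹ : ℝ) : ℂ) • (((√(boxSplineNormSq N r))⁻¹ : ℝ) : ℂ) •
        aeval ((ZMod.stdAddChar y : ℂ) • (G.toLinearEquiv : E →ₗ[ℂ] E)) (boxSpline N r) x := by
  rw [phaseState, aeval_smul_isometry_apply G _ _ (natDegree_boxSpline_lt hN hM)]
  congr 1
  simp only [stdAddChar_mul_eq_pow]
  rw [sum_zmod_val (fun j => (ZMod.stdAddChar y : ℂ) ^ j • clockAmp N r j • (G ^ j) x),
    Finset.smul_sum]
  refine Finset.sum_congr rfl fun j _ => ?_
  rw [clockAmp, mul_smul, smul_comm]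

/-- Phase estimation with a box-spline clock: on a vector with eigenphases `±ω`, where
`‖1 - exp (i ω)‖ = 2 √s`, the outcomes at distance at least `g` have small weight. -/
theorem sum_norm_sq_phaseState_le {M N r : ℕ} [NeZero M] (hN : 0 < N) (hM : (r + 1) * N ≤ M)
    {G : E ≃ₗᵢ[ℂ] E} {s g : ℝ} (hs : 0 ≤ s) (hg0 : 0 < g) (hgN : 4 ≤ g * N) {x : E}
    (hx : G x + G⁻¹ x = ((2 - 4 * s : ℝ) : ℂ) • x) (Y : Finset (ZMod M))
    (hY : ∀ y ∈ Y, g ≤ |‖1 - (ZMod.stdAddChar y : ℂ)‖ - 2 * √s|) :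
    ∑ y ∈ Y, ‖phaseState M N r G x y‖ ^ 2 ≤ (1 / 2) ^ r * ‖x‖ ^ 2 := by
  have hM0 : (0 : ℝ) < M := by exact_mod_cast NeZero.pos M
  set B := boxSplineNormSq N r with hB
  have hBp : 0 < B := boxSplineNormSq_pos hN
  set T : ZMod M → (E →ₗ[ℂ] E) := fun y => (ZMod.stdAddChar y : ℂ) • (G.toLinearEquiv : E →ₗ[ℂ] E)
  set b : ℂ[X] := ∑ i ∈ Finset.range N, X ^ i with hb
  have hNM : N ≤ M := le_trans (Nat.le_mul_of_pos_left N (by omega)) hM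
  -- Parseval for the box window
  have hbox : ∑ y, ‖aeval (T y) b x‖ ^ 2 = M * (N * ‖x‖ ^ 2) := by
    have hbd : b.natDegree < M := by
      have := natDegree_boxSpline_lt (r := 0) hN (M := M) (by simpa using hNM)
      simpa [boxSpline] using this
    have e : ∀ y, aeval (T y) b x = ∑ j : ZMod M, (ZMod.stdAddChar (y * j) : ℂ) •
        b.coeff j.val • (G ^ j.val) x := by
      intro y
      simp only [stdAddChar_mul_eq_pow]
      rw [sum_zmod_val (fun j => (ZMod.stdAddChar y : ℂ) ^ j • b.coeff j • (G ^ j) x)]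
      exact aeval_smul_isometry_apply G _ _ hbd x
    simp only [e, sum_norm_sq_dft]
    congr 1
    simp only [norm_smul, LinearIsometryEquiv.norm_map, mul_pow, ← Finset.sum_mul]
    congr 1
    rw [sum_zmod_val (fun j => ‖b.coeff j‖ ^ 2)]
    have hc : ∀ i, ‖b.coeff i‖ ^ 2 = if i < N then (1 : ℝ) else 0 := by
      intro i
      have : b.coeff i = if i < N then 1 else 0 := by
        simp [hb, coeff_X_pow]
      rw [this]; split_ifs <;> simp
    simp only [hc]
    rw [← Finset.sum_filter, Finset.sum_const, nsmul_one]
    congr 1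
    rw [← Finset.card_range N]
    congr 1
    ext i; simp; omega
  have key : ∀ y ∈ Y, g ^ (2 * r) * ‖aeval (T y) (boxSpline N r) x‖ ^ 2 ≤
      4 ^ r * ‖aeval (T y) b x‖ ^ 2 := by
    intro y hy
    have h1 := pow_mul_norm_le_aeval hs hg0.le (norm_stdAddChar y) (hY y hy) r
      (aeval_smul_isometry_mem (G := G) (ZMod.stdAddChar y : ℂ) (boxSpline N r) hx)
    -- With `b` the box, `(1 - X)^r b^{r+1} = (1 - X^N)^r b`: each factor `1 - X` costs at least `g`
    -- on the left, each `1 - X^N` at most `2` on the right, and Parseval controls the remaining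
    -- `b`.
    have h2 : aeval (T y) ((1 - X) ^ r : ℂ[X]) (aeval (T y) (boxSpline N r) x) =
        aeval (T y) ((1 - X ^ N) ^ r : ℂ[X]) (aeval (T y) b x) := by
      rw [← Module.End.mul_apply, ← Module.End.mul_apply, ← map_mul, ← map_mul]
      congr 2
      rw [boxSpline, ← hb, pow_succ b, ← mul_assoc, ← mul_pow, mul_neg_geom_sum]
    have h3 := norm_aeval_one_sub_pow_le G (norm_stdAddChar y) N r (aeval (T y) b x)
    have h4 : g ^ r * ‖aeval (T y) (boxSpline N r) x‖ ≤ 2 ^ r * ‖aeval (T y) b x‖ := by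
      refine h1.trans ?_
      change ‖aeval (T y) ((1 - X) ^ r : ℂ[X]) (aeval (T y) (boxSpline N r) x)‖ ≤ _
      rw [h2]; exact h3
    calc _ = (g ^ r * ‖aeval (T y) (boxSpline N r) x‖) ^ 2 := by rw [mul_pow]; ring
      _ ≤ (2 ^ r * ‖aeval (T y) b x‖) ^ 2 := by gcongr
      _ = _ := by rw [mul_pow, ← pow_mul, mul_comm r 2, pow_mul]; norm_num
  have hsum : g ^ (2 * r) * ∑ y ∈ Y, ‖aeval (T y) (boxSpline N r) x‖ ^ 2 ≤
      4 ^ r * (M * (N * ‖x‖ ^ 2)) := by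
    rw [← hbox, Finset.mul_sum, Finset.mul_sum]
    refine (Finset.sum_le_sum key).trans ?_
    exact Finset.sum_le_sum_of_subset_of_nonneg (Finset.subset_univ _)
      fun _ _ _ => by positivity
  have hPS : ∑ y ∈ Y, ‖phaseState M N r G x y‖ ^ 2 =
      (M * B)⁻¹ * ∑ y ∈ Y, ‖aeval (T y) (boxSpline N r) x‖ ^ 2 := by
    rw [Finset.mul_sum]
    refine Finset.sum_congr rfl fun y _ => ?_
    rw [phaseState_eq hN hM, norm_smul, norm_smul, mul_pow, mul_pow, Complex.norm_real,
      Complex.norm_real, Real.norm_eq_abs, Real.norm_eq_abs, sq_abs, sq_abs, inv_pow, inv_pow,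
      Real.sq_sqrt hM0.le, Real.sq_sqrt hBp.le, mul_inv, mul_assoc]
  rw [hPS, inv_mul_le_iff₀ (by positivity)]
  have hN0 : (0 : ℝ) < N := by exact_mod_cast hN
  have hlow := boxSpline_norm_lower (r := r) hN
  rw [← hB] at hlow
  refine le_of_mul_le_mul_left (hsum.trans ?_) (by positivity : (0 : ℝ) < g ^ (2 * r))
  -- The tail is at most `(r+1) 4^r / (gN)^{2r}`; with `r + 1 ≤ 2^r` and `gN ≥ 4` this is at most
  -- `8^r / 16^r`.
  have hr : ((r : ℝ) + 1) ≤ 2 ^ r := by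
    have := Nat.lt_two_pow_self (n := r)
    exact_mod_cast this
  have h16 : (16 : ℝ) ^ r ≤ g ^ (2 * r) * N ^ (2 * r) := by
    rw [← mul_pow, pow_mul]
    exact pow_le_pow_left₀ (by norm_num) (by nlinarith) r
  have hBl : (N : ℝ) * N ^ (2 * r) ≤ 2 ^ r * B := by
    calc (N : ℝ) * N ^ (2 * r) = (N : ℝ) ^ (2 * r + 1) := by ring
      _ ≤ _ := hlow
      _ ≤ _ := by gcongr
  have hfin : (4 : ℝ) ^ r * N ≤ g ^ (2 * r) * (B * (1 / 2) ^ r) := by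
    have h16' : (16 : ℝ) ^ r = 4 ^ r * (2 ^ r * 2 ^ r) := by
      rw [← mul_pow, ← mul_pow]; norm_num
    have e1 : (4 : ℝ) ^ r * N * (2 ^ r * 2 ^ r) ≤ g ^ (2 * r) * (2 ^ r * B) := by
      calc (4 : ℝ) ^ r * N * (2 ^ r * 2 ^ r) = 16 ^ r * N := by rw [h16']; ring
        _ ≤ g ^ (2 * r) * N ^ (2 * r) * N := by gcongr
        _ = g ^ (2 * r) * (N * N ^ (2 * r)) := by ring
        _ ≤ _ := by gcongr
    have e2 : (1 / 2 : ℝ) ^ r * 2 ^ r = 1 := by rw [← mul_pow]; norm_num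
    have e3 : (0 : ℝ) < 2 ^ r * 2 ^ r := by positivity
    refine le_of_mul_le_mul_right (e1.trans (le_of_eq ?_)) e3
    calc _ = g ^ (2 * r) * (2 ^ r * B) * 1 := by ring
      _ = g ^ (2 * r) * (2 ^ r * B) * ((1 / 2 : ℝ) ^ r * 2 ^ r) := by rw [e2]
      _ = _ := by ring
  calc (4 : ℝ) ^ r * (M * (N * ‖x‖ ^ 2)) = (4 : ℝ) ^ r * N * (M * ‖x‖ ^ 2) := by ring
    _ ≤ g ^ (2 * r) * (B * (1 / 2) ^ r) * (M * ‖x‖ ^ 2) := by gcongr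
    _ = _ := by ring

end Walk

/-! ### Counting oracle calls -/

/-- Families of group elements that are products of fixed elements and `q` oracle calls. -/
inductive QueryImpl {α Γ : Type*} [Group Γ] (O : α → Γ) : ℕ → (α → Γ) → Prop
  | const (U : Γ) : QueryImpl O 0 fun _ => U
  | step (U : Γ) {q : ℕ} {W : α → Γ} : QueryImpl O q W → QueryImpl O (q + 1) fun a => U * (O a * W a)

namespace QueryImpl

variable {α Γ Γ' : Type*} [Group Γ] [Group Γ'] {O : α → Γ} {q q₁ q₂ : ℕ} {W W₁ W₂ : α → Γ}

theorem of_eq (h : QueryImpl O q₁ W₁) (hq : q₁ = q₂) (hW : ∀ a, W₁ a = W₂ a) :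
    QueryImpl O q₂ W₂ := by
  obtain rfl := hq
  obtain rfl := funext hW
  exact h

theorem oracle : QueryImpl O 1 O :=
  (step 1 (const 1)).of_eq rfl fun a => by simp

theorem const_mul (U : Γ) (h : QueryImpl O q W) : QueryImpl O q fun a => U * W a := by
  cases h with
  | const V => exact const (U * V)
  | step V h => exact (step (U * V) h).of_eq rfl fun a => by simp [mul_assoc]

theorem mul (h₁ : QueryImpl O q₁ W₁) (h₂ : QueryImpl O q₂ W₂) :
    QueryImpl O (q₁ + q₂) fun a => W₁ a * W₂ a := by
  induction h₁ with
  | const U => exact (const_mul U h₂).of_eq (by omega) fun _ => rfl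
  | step U _ ih => exact (step U ih).of_eq (by omega) fun a => by simp [mul_assoc]

theorem pow (h : QueryImpl O q W) (k : ℕ) : QueryImpl O (k * q) fun a => W a ^ k := by
  induction k with
  | zero => exact (const 1).of_eq (by simp) (by simp)
  | succ k ih => exact (ih.mul h).of_eq (by ring) fun a => (pow_succ _ _).symm

/-- The oracle is its own inverse, so undoing a computation costs no more queries than running it.
-/
theorem inv (hO : ∀ a, O a * O a = 1) (h : QueryImpl O q W) :
    QueryImpl O q fun a => (W a)⁻¹ := by
  induction h with
  | const U => exact const U⁻¹
  | step U _ ih =>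
    exact (ih.mul ((const U⁻¹).step 1)).of_eq (by omega) fun a => by
      have : (O a)⁻¹ = O a := inv_eq_of_mul_eq_one_left (hO a)
      simp [mul_inv_rev, mul_assoc, this]

theorem map (φ : Γ →* Γ') (h : QueryImpl O q W) :
    QueryImpl (fun a => φ (O a)) q fun a => φ (W a) := by
  induction h with
  | const U => exact const (φ U)
  | step U _ ih => exact (step (φ U) ih).of_eq rfl fun a => by simp

/-- The state reached after `t` oracle calls. -/
def run (U : ℕ → Γ) (g : Γ) : ℕ → Γ
  | 0 => U 0
  | t + 1 => U (t + 1) * (g * run U g t)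

theorem run_congr {U U' : ℕ → Γ} (g : Γ) (t : ℕ) (h : ∀ i ≤ t, U i = U' i) :
    run U g t = run U' g t := by
  induction t with
  | zero => exact h 0 le_rfl
  | succ t ih => simp only [run, h (t + 1) le_rfl, ih fun i hi => h i (by omega)]

theorem exists_run (h : QueryImpl O q W) : ∃ U : ℕ → Γ, ∀ a, W a = run U (O a) q := by
  induction h with
  | const U => exact ⟨fun _ => U, fun _ => rfl⟩
  | @step V q W _ ih =>
    obtain ⟨U, hU⟩ := ih
    refine ⟨Function.update U (q + 1) V, fun a => ?_⟩
    change V * (O a * W a) = _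
    rw [run, Function.update_self, hU]
    congr 2
    exact run_congr _ _ fun i hi => (Function.update_of_ne (by omega) _ _).symm

end QueryImpl

/-! ### Block unitaries and the postselected test -/

section Operators

variable {ι : Type*} [Fintype ι] {H : Type*} [NormedAddCommGroup H]

theorem norm_sq_block (x : PiLp 2 (fun _ : ι => H)) : ‖x‖ ^ 2 = ∑ i, ‖x i‖ ^ 2 :=
  PiLp.norm_sq_eq_of_L2 _ x

variable [InnerProductSpace ℂ H]

/-- Block-diagonal unitaries. -/
noncomputable def blockDiag : (ι → (H ≃ₗᵢ[ℂ] H)) →*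
    (PiLp 2 (fun _ : ι => H) ≃ₗᵢ[ℂ] PiLp 2 (fun _ : ι => H)) where
  toFun e := LinearIsometryEquiv.piLpCongrRight 2 e
  map_one' := by ext; simp
  map_mul' e e' := by ext; simp

@[simp]
theorem blockDiag_apply (e : ι → (H ≃ₗᵢ[ℂ] H)) (x : PiLp 2 (fun _ : ι => H)) (i : ι) :
    blockDiag e x i = e i (x i) := by
  simp [blockDiag]

/-- The same unitary on all blocks. -/
noncomputable def blockConst (ι : Type*) [Fintype ι] : (H ≃ₗᵢ[ℂ] H) →*
    (PiLp 2 (fun _ : ι => H) ≃ₗᵢ[ℂ] PiLp 2 (fun _ : ι => H)) :=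
  blockDiag.comp (Pi.constMonoidHom ι (H ≃ₗᵢ[ℂ] H))

@[simp]
theorem blockConst_apply (e : H ≃ₗᵢ[ℂ] H) (x : PiLp 2 (fun _ : ι => H)) (i : ι) :
    blockConst ι e x i = e (x i) := by
  simp [blockConst]

theorem norm_eq_of_sq_eq {a b : ℝ} (ha : 0 ≤ a) (hb : 0 ≤ b) (h : a ^ 2 = b ^ 2) : a = b :=
  (pow_left_inj₀ ha hb two_ne_zero).1 h

variable {M : ℕ} [NeZero M]

/-- The counter register holds at most `s`, and the part where it is `0` is `v`. -/
def CounterSlice (s : ℕ) (v : H) (x : PiLp 2 (fun _ : ZMod M => H)) : Prop :=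
  x 0 = v ∧ ∀ c : ZMod M, s < c.val → x c = 0

theorem CounterSlice.blockConst {s : ℕ} {v : H} {x : PiLp 2 (fun _ : ZMod M => H)}
    (h : CounterSlice s v x) (W : H ≃ₗᵢ[ℂ] H) : CounterSlice s (W v) (blockConst (ZMod M) W x) := by
  refine ⟨by rw [blockConst_apply, h.1], fun c hc => ?_⟩
  rw [blockConst_apply, h.2 c hc, map_zero]

variable [FiniteDimensional ℂ H]

/-- Used to prepare an arbitrary initial vector from the all-zero state by a query-free unitary. -/
theorem exists_isometry_apply_eq {x y : H} (hx : ‖x‖ = 1) (hy : ‖y‖ = 1) :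
    ∃ U : H ≃ₗᵢ[ℂ] H, U x = y := by
  let L : (Submodule.span ℂ {x}) →ₗᵢ[ℂ] H :=
    (LinearIsometry.toSpanSingleton ℂ H hy).comp
      (LinearIsometryEquiv.toSpanUnitSingleton x hx).symm.toLinearIsometry
  refine ⟨L.extend.toLinearIsometryEquiv rfl, ?_⟩
  have h := L.extend_apply ⟨x, Submodule.mem_span_singleton_self x⟩
  have h1 : (LinearIsometryEquiv.toSpanUnitSingleton x hx).symm
      ⟨x, Submodule.mem_span_singleton_self x⟩ = (1 : ℂ) := by
    rw [LinearIsometryEquiv.symm_apply_eq]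
    simp [LinearIsometryEquiv.toSpanUnitSingleton_apply]
  change L.extend x = y
  refine h.trans ?_
  simp [L, h1]

/-- The discrete Fourier transform on the clock register. -/
noncomputable def clockFourier : PiLp 2 (fun _ : ZMod M => H) ≃ₗᵢ[ℂ] PiLp 2 (fun _ : ZMod M => H) :=
  LinearIsometry.toLinearIsometryEquiv
    { toFun := fun x => WithLp.toLp 2 fun y => (((√M)⁻¹ : ℝ) : ℂ) •
        ∑ j : ZMod M, (ZMod.stdAddChar (y * j) : ℂ) • x j
      map_add' := fun x x' => by
        ext y; simp [Finset.sum_add_distrib]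
      map_smul' := fun c x => by
        ext y
        simp only [PiLp.smul_apply, RingHom.id_apply]
        rw [smul_comm c, Finset.smul_sum (r := c)]
        congr 1
        exact Finset.sum_congr rfl fun j _ => smul_comm _ _ _
      norm_map' := fun x => by
        refine norm_eq_of_sq_eq (norm_nonneg _) (norm_nonneg _) ?_
        have hM0 : (0 : ℝ) < M := by exact_mod_cast NeZero.pos M
        rw [norm_sq_block, norm_sq_block]
        simp only [LinearMap.coe_mk, AddHom.coe_mk, norm_smul, mul_pow, ← Finset.mul_sum]
        rw [sum_norm_sq_dft, Complex.norm_real, Real.norm_eq_abs, sq_abs, inv_pow,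
          Real.sq_sqrt hM0.le, ← mul_assoc, inv_mul_cancel₀ hM0.ne', one_mul] }
    rfl

theorem clockFourier_apply (x : PiLp 2 (fun _ : ZMod M => H)) (y : ZMod M) :
    (clockFourier x : PiLp 2 (fun _ : ZMod M => H)) y = (((√M)⁻¹ : ℝ) : ℂ) • ∑ j : ZMod M, (ZMod.stdAddChar (y * j) : ℂ) • x j :=
  rfl

theorem norm_sq_starProjection_add (K : Submodule ℂ H) (a b : H) :
    ‖K.starProjection a + (b - K.starProjection b)‖ ^ 2 =
      ‖K.starProjection a‖ ^ 2 + ‖b - K.starProjection b‖ ^ 2 := by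
  have h : inner ℂ (K.starProjection a) (b - K.starProjection b) = 0 :=
    Submodule.inner_right_of_mem_orthogonal (K.starProjection_apply_mem a)
      (Submodule.sub_starProjection_mem_orthogonal b)
  rw [norm_add_sq (𝕜 := ℂ), h]; simp

/-- Increments the counter register exactly on the orthogonal complement of `K`. -/
noncomputable def flagIncr (K : Submodule ℂ H) :
    PiLp 2 (fun _ : ZMod M => H) ≃ₗᵢ[ℂ] PiLp 2 (fun _ : ZMod M => H) :=
  LinearIsometry.toLinearIsometryEquiv
    { toFun := fun x => WithLp.toLp 2 fun c =>
        K.starProjection (x c) + (x (c - 1) - K.starProjection (x (c - 1)))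
      map_add' := fun x x' => by
        ext c; simp only [PiLp.add_apply, map_add]; abel
      map_smul' := fun a x => by
        ext c; simp only [PiLp.smul_apply, map_smul, RingHom.id_apply, smul_add, smul_sub]
      norm_map' := fun x => by
        refine norm_eq_of_sq_eq (norm_nonneg _) (norm_nonneg _) ?_
        rw [norm_sq_block, norm_sq_block]
        simp only [LinearMap.coe_mk, AddHom.coe_mk, norm_sq_starProjection_add,
          Finset.sum_add_distrib]
        -- The shift only permutes the complement parts among the blocks, so Pythagoras in each
        -- block preserves the total norm.
        have hshift := (Equiv.subRight (1 : ZMod M)).sum_comp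
          (fun c => ‖x c - K.starProjection (x c)‖ ^ 2)
        simp only [Equiv.subRight_apply] at hshift
        rw [hshift, ← Finset.sum_add_distrib]
        refine Finset.sum_congr rfl fun c _ => ?_
        rw [← norm_sq_starProjection_add]
        simp }
    rfl

theorem flagIncr_apply (K : Submodule ℂ H) (x : PiLp 2 (fun _ : ZMod M => H)) (c : ZMod M) :
    flagIncr K x c = K.starProjection (x c) + (x (c - 1) - K.starProjection (x (c - 1))) :=
  rfl

/-- The block that would wrap around into counter `0` is `M - 1`, which exceeds `s` and is therefore
empty. -/
theorem CounterSlice.flagIncr {s : ℕ} {v : H} {x : PiLp 2 (fun _ : ZMod M => H)}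
    (h : CounterSlice s v x) (K : Submodule ℂ H) (hs : s + 1 < M) :
    CounterSlice (s + 1) (K.starProjection v) (flagIncr K x) := by
  have : Fact (1 < M) := ⟨by omega⟩
  refine ⟨?_, fun c hc => ?_⟩
  · have h1 : x (0 - 1) = 0 := by
      refine h.2 _ ?_
      rw [zero_sub, ZMod.neg_val, if_neg one_ne_zero, ZMod.val_one]
      omega
    rw [flagIncr_apply, h.1, h1]; simp
  · have h1 : (c - 1).val = c.val - 1 := by
      rw [ZMod.val_sub] <;> rw [ZMod.val_one]
      omega
    rw [flagIncr_apply, h.2 c (by omega), h.2 (c - 1) (by omega)]; simp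

/-- The vectors of a register-valued space that vanish on the blocks in `Y`. -/
def vanishingOn (ι : Type*) [Fintype ι] (H : Type*) [NormedAddCommGroup H] [InnerProductSpace ℂ H]
    (Y : Finset ι) : Submodule ℂ (PiLp 2 (fun _ : ι => H)) where
  carrier := {x | ∀ y ∈ Y, x y = 0}
  add_mem' := fun ha hb y hy => by simp [ha y hy, hb y hy]
  zero_mem' := fun y _ => by simp
  smul_mem' := fun c x hx y hy => by simp [hx y hy]

open Classical in
theorem starProjection_vanishingOn (Y : Finset ι) (x : PiLp 2 (fun _ : ι => H)) :
    (vanishingOn ι H Y).starProjection x = WithLp.toLp 2 fun y => if y ∈ Y then 0 else x y := by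
  refine Submodule.eq_starProjection_of_mem_of_inner_eq_zero ?_ ?_
  · intro y hy; simp [hy]
  · intro w hw
    rw [PiLp.inner_apply]
    refine Finset.sum_eq_zero fun y _ => ?_
    by_cases hy : y ∈ Y
    · rw [hw y hy, inner_zero_right]
    · simp [hy]

theorem inner_starProjection_vanishingOn (Y : Finset ι) (x : PiLp 2 (fun _ : ι => H)) :
    inner ℂ x ((vanishingOn ι H Y).starProjection x) =
      ((‖x‖ ^ 2 - ∑ y ∈ Y, ‖x y‖ ^ 2 : ℝ) : ℂ) := by
  classical
  rw [starProjection_vanishingOn, PiLp.inner_apply]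
  have h : ∀ y, inner ℂ (x y) (if y ∈ Y then 0 else x y) =
      (((‖x y‖ ^ 2 - if y ∈ Y then ‖x y‖ ^ 2 else 0) : ℝ) : ℂ) := by
    intro y
    by_cases hy : y ∈ Y <;> simp [hy, inner_self_eq_norm_sq_to_K]
  simp only [h]
  rw [← Complex.ofReal_sum, Finset.sum_sub_distrib, norm_sq_block]
  simp

/-- One round of a postselected test: the counter is incremented if `Y` is seen after `W`, and if
the register is not back in the state `v` after `W⁻¹`. -/
noncomputable def testRound (W : PiLp 2 (fun _ : ι => H) ≃ₗᵢ[ℂ] PiLp 2 (fun _ : ι => H))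
    (Y : Finset ι) (v : PiLp 2 (fun _ : ι => H)) :
    PiLp 2 (fun _ : ZMod M => PiLp 2 (fun _ : ι => H)) ≃ₗᵢ[ℂ]
      PiLp 2 (fun _ : ZMod M => PiLp 2 (fun _ : ι => H)) :=
  flagIncr (Submodule.span ℂ {v}) * (blockConst (ZMod M) W⁻¹ *
    (flagIncr (vanishingOn ι H Y) * blockConst (ZMod M) W))

/-- With `P` the projection away from `Y`, the counter-zero amplitude is multiplied by `⟨v, W⁻¹ P W
v⟩ = ‖P W v‖²`, the probability of not seeing `Y`. The two flags raise the counter by at most two.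
-/
theorem CounterSlice.testRound {W : PiLp 2 (fun _ : ι => H) ≃ₗᵢ[ℂ] PiLp 2 (fun _ : ι => H)}
    {Y : Finset ι} {v : PiLp 2 (fun _ : ι => H)} (hv : ‖v‖ = 1) {s : ℕ} {a : ℂ}
    {x : PiLp 2 (fun _ : ZMod M => PiLp 2 (fun _ : ι => H))} (h : CounterSlice s (a • v) x)
    (hs : s + 2 < M) :
    CounterSlice (s + 2) ((a * ((1 - ∑ y ∈ Y, ‖W v y‖ ^ 2 : ℝ) : ℂ)) • v) (testRound W Y v x) := by
  have h1 := (((h.blockConst W).flagIncr (vanishingOn ι H Y) (by omega)).blockConst W⁻¹).flagIncr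
    (Submodule.span ℂ {v}) (by omega)
  have e : (Submodule.span ℂ {v}).starProjection
      (W⁻¹ ((vanishingOn ι H Y).starProjection (W (a • v)))) =
        (a * ((1 - ∑ y ∈ Y, ‖W v y‖ ^ 2 : ℝ) : ℂ)) • v := by
    rw [Submodule.starProjection_unit_singleton ℂ hv]
    congr 1
    rw [map_smul, map_smul, map_smul, inner_smul_right]
    congr 1
    rw [← W.inner_map_map]
    have : W (W⁻¹ ((vanishingOn ι H Y).starProjection (W v))) =
        (vanishingOn ι H Y).starProjection (W v) := W.apply_symm_apply _
    rw [this, inner_starProjection_vanishingOn, W.norm_map, hv, one_pow]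
  rw [e] at h1
  exact h1

theorem counterSlice_testRound_pow {W : PiLp 2 (fun _ : ι => H) ≃ₗᵢ[ℂ] PiLp 2 (fun _ : ι => H)}
    {Y : Finset ι} {v : PiLp 2 (fun _ : ι => H)} (hv : ‖v‖ = 1)
    {x : PiLp 2 (fun _ : ZMod M => PiLp 2 (fun _ : ι => H))} (h : CounterSlice 0 v x) (R : ℕ)
    (hR : 2 * R < M) :
    CounterSlice (2 * R) ((((1 - ∑ y ∈ Y, ‖W v y‖ ^ 2) ^ R : ℝ) : ℂ) • v)
      ((testRound W Y v ^ R) x) := by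
  induction R with
  | zero => simpa using h
  | succ R ih =>
    have h1 := (ih (by omega)).testRound (W := W) (Y := Y) hv (by omega)
    rw [pow_succ' (testRound W Y v), pow_succ, Complex.ofReal_mul]
    exact h1

end Operators

/-! ### Translation to the qubit model -/

section Bridge

variable {n m w : ℕ}

/-- What the oracle does to the value register when the index register holds `i`. -/
def oracleShift (A : Fin n → Fin m) (i : BitVec (Nat.clog 2 n)) (v : BitVec (Nat.clog 2 m)) :
    BitVec (Nat.clog 2 m) :=
  if h : i.toNat < n then v ^^^ BitVec.ofNat (Nat.clog 2 m) (A ⟨i.toNat, h⟩).val else v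

theorem oracleShift_oracleShift (A : Fin n → Fin m) (i : BitVec (Nat.clog 2 n))
    (v : BitVec (Nat.clog 2 m)) : oracleShift A i (oracleShift A i v) = v := by
  unfold oracleShift
  split_ifs with h
  · rw [BitVec.xor_assoc, BitVec.xor_self, BitVec.xor_zero]
  · rfl

/-- The oracle acts on the value register by an involution. -/
def oracleShiftEquiv (A : Fin n → Fin m) (i : BitVec (Nat.clog 2 n)) :
    BitVec (Nat.clog 2 m) ≃ BitVec (Nat.clog 2 m) :=
  ⟨oracleShift A i, oracleShift A i, oracleShift_oracleShift A i, oracleShift_oracleShift A i⟩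

theorem oracleMap_eq (A : Fin n → Fin m) (s : QBasis n m w) :
    oracleMap w A s = (s.1, oracleShift A s.1 s.2.1, s.2.2) := by
  unfold oracleMap oracleShift
  split_ifs <;> rfl

/-- The oracle as a permutation of the computational basis. -/
def oracleEquiv (w : ℕ) (A : Fin n → Fin m) : QBasis n m w ≃ QBasis n m w :=
  Equiv.prodShear (Equiv.refl _) fun i => (oracleShiftEquiv A i).prodCongr (Equiv.refl _)

theorem oracleEquiv_apply (A : Fin n → Fin m) (s : QBasis n m w) :
    oracleEquiv w A s = oracleMap w A s := by
  rw [oracleMap_eq]; rfl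

theorem oracleMap_oracleMap (A : Fin n → Fin m) (s : QBasis n m w) :
    oracleMap w A (oracleMap w A s) = s := by
  simp [oracleMap_eq, oracleShift_oracleShift]

theorem oracleMatrix_mulVec (A : Fin n → Fin m) (x : QBasis n m w → ℂ) (s : QBasis n m w) :
    (oracleMatrix w A).mulVec x s = x (oracleMap w A s) := by
  have h : ∀ t, (s = oracleMap w A t) ↔ (t = oracleMap w A s) := fun t =>
    ⟨fun h => by rw [h, oracleMap_oracleMap], fun h => by rw [h, oracleMap_oracleMap]⟩
  simp [Matrix.mulVec, dotProduct, oracleMatrix, h]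

/-- The oracle as a unitary. -/
noncomputable def oracleIso (w : ℕ) (A : Fin n → Fin m) :
    EuclideanSpace ℂ (QBasis n m w) ≃ₗᵢ[ℂ] EuclideanSpace ℂ (QBasis n m w) :=
  LinearIsometryEquiv.piLpCongrLeft 2 ℂ ℂ (oracleEquiv w A)

theorem oracleIso_apply (A : Fin n → Fin m) (x : EuclideanSpace ℂ (QBasis n m w))
    (s : QBasis n m w) : oracleIso w A x s = x (oracleMap w A s) := by
  have h : (oracleEquiv w A).symm s = oracleMap w A s := by
    rw [Equiv.symm_apply_eq, oracleEquiv_apply, oracleMap_oracleMap]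
  rw [oracleIso, LinearIsometryEquiv.piLpCongrLeft_apply, Equiv.piCongrLeft'_apply, h]

/-- The matrix of a unitary operator. -/
noncomputable def isometryMatrix {κ : Type*} [Fintype κ] [DecidableEq κ]
    (W : EuclideanSpace ℂ κ ≃ₗᵢ[ℂ] EuclideanSpace ℂ κ) : Matrix.unitaryGroup κ ℂ :=
  ⟨(Matrix.toEuclideanCLM (n := κ) (𝕜 := ℂ)).symm (Unitary.linearIsometryEquiv.symm W).val, by
    set φ := Matrix.toEuclideanCLM (n := κ) (𝕜 := ℂ)
    set B := (Unitary.linearIsometryEquiv.symm W).val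
    have h : B * star B = 1 :=
      Unitary.mul_star_self_of_mem (Unitary.linearIsometryEquiv.symm W).2
    have h1 : φ (φ.symm B) = B := StarAlgEquiv.apply_symm_apply _ _
    rw [Matrix.mem_unitaryGroup_iff]
    apply φ.injective
    refine (φ.map_mul' (φ.symm B) (star (φ.symm B))).trans ?_
    refine (congrArg₂ (· * ·) h1 ((φ.map_star' (φ.symm B)).trans (congrArg star h1))).trans ?_
    exact h.trans (map_one φ).symm⟩

theorem isometryMatrix_mulVec {κ : Type*} [Fintype κ] [DecidableEq κ]
    (W : EuclideanSpace ℂ κ ≃ₗᵢ[ℂ] EuclideanSpace ℂ κ) (x : EuclideanSpace ℂ κ) :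
    (isometryMatrix W).val.mulVec x = W x := by
  have h := Matrix.toEuclideanCLM_toLp (𝕜 := ℂ) (isometryMatrix W).val x
  have h2 : Matrix.toEuclideanCLM (n := κ) (𝕜 := ℂ) (isometryMatrix W).val =
      (Unitary.linearIsometryEquiv.symm W).val :=
    (Matrix.toEuclideanCLM (n := κ) (𝕜 := ℂ)).apply_symm_apply _
  rw [h2] at h
  exact (congrArg WithLp.ofLp h).symm

/-- A product of `q` oracle calls and fixed unitaries is a query algorithm with `q` queries. -/
theorem QueryImpl.exists_queryAlgorithm {q : ℕ} {W : (Fin n → Fin m) →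
      (EuclideanSpace ℂ (QBasis n m w) ≃ₗᵢ[ℂ] EuclideanSpace ℂ (QBasis n m w))}
    (hW : QueryImpl (oracleIso w) q W) (accept : Finset (QBasis n m w)) :
    ∃ alg : QueryAlgorithm n m, alg.numQueries = q ∧
      alg.numQubits = Nat.clog 2 n + Nat.clog 2 m + w ∧
      ∀ A, alg.acceptProb A = ∑ s ∈ accept, ‖W A (EuclideanSpace.single 0 1) s‖ ^ 2 := by
  obtain ⟨U, hU⟩ := hW.exists_run
  let alg : QueryAlgorithm n m := ⟨w, q, fun t => isometryMatrix (U t), accept⟩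
  have hstate : ∀ A t, alg.state A t = QueryImpl.run U (oracleIso w A) t (EuclideanSpace.single 0 1) := by
    intro A t
    induction t with
    | zero => exact isometryMatrix_mulVec (U 0) (EuclideanSpace.single 0 1)
    | succ t ih =>
      rw [QueryAlgorithm.state, ih]
      have h : (oracleMatrix w A).mulVec (QueryImpl.run U (oracleIso w A) t
          (EuclideanSpace.single 0 1)) = oracleIso w A (QueryImpl.run U (oracleIso w A) t
          (EuclideanSpace.single 0 1)) := by
        funext s
        rw [oracleMatrix_mulVec, oracleIso_apply]
      exact (congrArg _ h).trans (isometryMatrix_mulVec (U (t + 1)) _)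
  refine ⟨alg, rfl, rfl, fun A => ?_⟩
  rw [hU A]
  simp only [QueryAlgorithm.acceptProb, hstate]
  rfl

/-- Amplitudes on the index and value registers. -/
abbrev QRegs (n m : ℕ) : Type :=
  PiLp 2 (fun _ : BitVec (Nat.clog 2 m) => EuclideanSpace ℂ (BitVec (Nat.clog 2 n)))

/-- The oracle on the index and value registers. -/
noncomputable def regOracle (A : Fin n → Fin m) : QRegs n m ≃ₗᵢ[ℂ] QRegs n m :=
  LinearIsometry.toLinearIsometryEquiv
    { toFun := fun x => WithLp.toLp 2 fun v => WithLp.toLp 2 fun i => x (oracleShift A i v) i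
      map_add' := fun x x' => rfl
      map_smul' := fun c x => rfl
      norm_map' := fun x => by
        refine norm_eq_of_sq_eq (norm_nonneg _) (norm_nonneg _) ?_
        simp only [norm_sq_block]
        change (∑ v, ∑ i, ‖x (oracleShift A i v) i‖ ^ 2) = _
        rw [Finset.sum_comm, Finset.sum_comm (f := fun v i => ‖x v i‖ ^ 2)]
        exact Finset.sum_congr rfl fun i _ =>
          (oracleShiftEquiv A i).sum_comp fun v => ‖x v i‖ ^ 2 }
    rfl

theorem regOracle_apply (A : Fin n → Fin m) (x : QRegs n m) (v : BitVec (Nat.clog 2 m))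
    (i : BitVec (Nat.clog 2 n)) : regOracle A x v i = x (oracleShift A i v) i :=
  rfl

theorem regOracle_mul_self (A : Fin n → Fin m) : regOracle A * regOracle A = 1 := by
  ext x v i
  change regOracle A (regOracle A x) v i = x v i
  rw [regOracle_apply, regOracle_apply, oracleShift_oracleShift]

variable {γ κ : Type*} [Fintype γ] [Fintype κ]

theorem sum_splitRegs (e : BitVec w ≃ γ × κ) (f : QBasis n m w → ℝ) :
    ∑ s, f s = ∑ c, ∑ y, ∑ v, ∑ i, f (i, v, e.symm (c, y)) := by
  let E : (((γ × κ) × BitVec (Nat.clog 2 m)) × BitVec (Nat.clog 2 n)) ≃ QBasis n m w :=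
    ⟨fun p => (p.2, p.1.2, e.symm p.1.1), fun s => ((e s.2.2, s.2.1), s.1),
      fun p => by simp, fun s => by simp⟩
  rw [← E.sum_comp]
  simp only [Fintype.sum_prod_type]
  rfl

/-- Splitting the work qubits into a counter and a clock register. -/
noncomputable def splitRegs (e : BitVec w ≃ γ × κ) : EuclideanSpace ℂ (QBasis n m w) ≃ₗᵢ[ℂ]
    PiLp 2 (fun _ : γ => PiLp 2 (fun _ : κ => QRegs n m)) where
  toFun x := WithLp.toLp 2 fun c => WithLp.toLp 2 fun y => WithLp.toLp 2 fun v =>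
    WithLp.toLp 2 fun i => x (i, v, e.symm (c, y))
  map_add' x x' := rfl
  map_smul' c x := rfl
  invFun ψ := WithLp.toLp 2 fun s => ψ (e s.2.2).1 (e s.2.2).2 s.2.1 s.1
  left_inv x := by ext s; simp
  right_inv ψ := by ext c y v i; simp
  norm_map' x := by
    refine norm_eq_of_sq_eq (norm_nonneg _) (norm_nonneg _) ?_
    simp only [norm_sq_block]
    exact (sum_splitRegs e fun s => ‖x s‖ ^ 2).symm

theorem splitRegs_apply (e : BitVec w ≃ γ × κ) (x : EuclideanSpace ℂ (QBasis n m w)) (c : γ)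
    (y : κ) (v : BitVec (Nat.clog 2 m)) (i : BitVec (Nat.clog 2 n)) :
    splitRegs e x c y v i = x (i, v, e.symm (c, y)) :=
  rfl

/-- Conjugation by `splitRegs`. -/
noncomputable def conjSplitRegs (e : BitVec w ≃ γ × κ) :
    (PiLp 2 (fun _ : γ => PiLp 2 (fun _ : κ => QRegs n m)) ≃ₗᵢ[ℂ]
      PiLp 2 (fun _ : γ => PiLp 2 (fun _ : κ => QRegs n m))) →*
    (EuclideanSpace ℂ (QBasis n m w) ≃ₗᵢ[ℂ] EuclideanSpace ℂ (QBasis n m w)) where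
  toFun W := ((splitRegs e).trans W).trans (splitRegs e).symm
  map_one' := by ext x : 1; simp
  map_mul' W W' := by ext x : 1; simp

/-- The oracle does not touch the work qubits, so any bijection `e` between their basis states and
counter–clock pairs will do. -/
theorem conjSplitRegs_oracle (e : BitVec w ≃ γ × κ) (A : Fin n → Fin m) :
    conjSplitRegs e (blockConst γ (blockConst κ (regOracle A))) = oracleIso w A := by
  ext x : 1
  change (splitRegs e).symm (blockConst γ (blockConst κ (regOracle A)) (splitRegs e x)) = _
  rw [LinearIsometryEquiv.symm_apply_eq]
  ext c y v i
  rw [blockConst_apply, blockConst_apply, regOracle_apply, splitRegs_apply, splitRegs_apply,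
    oracleIso_apply, oracleMap_eq]

/-- A product of `q` oracle calls and fixed unitaries on the split registers, run from any fixed
unit vector, is a query algorithm that rejects when the counter is zero. -/
theorem QueryImpl.exists_counterAlgorithm [Zero γ] [DecidableEq γ] (e : BitVec w ≃ γ × κ) {q : ℕ}
    {W : (Fin n → Fin m) → (PiLp 2 (fun _ : γ => PiLp 2 (fun _ : κ => QRegs n m)) ≃ₗᵢ[ℂ]
      PiLp 2 (fun _ : γ => PiLp 2 (fun _ : κ => QRegs n m)))}
    (hW : QueryImpl (fun A => blockConst γ (blockConst κ (regOracle A))) q W)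
    {x₀ : PiLp 2 (fun _ : γ => PiLp 2 (fun _ : κ => QRegs n m))} (hx₀ : ‖x₀‖ = 1) :
    ∃ alg : QueryAlgorithm n m, alg.numQueries = q ∧
      alg.numQubits = Nat.clog 2 n + Nat.clog 2 m + w ∧
      ∀ A, alg.acceptProb A = 1 - ‖W A x₀ 0‖ ^ 2 := by
  have h1 : ‖splitRegs (n := n) (m := m) e (EuclideanSpace.single 0 1)‖ = 1 := by
    rw [LinearIsometryEquiv.norm_map]; simp
  obtain ⟨P, hP⟩ := exists_isometry_apply_eq h1 hx₀
  have h2 : QueryImpl (oracleIso w) q (fun A => conjSplitRegs e (W A * P)) := by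
    have h3 := ((hW.mul (QueryImpl.const P)).map (conjSplitRegs e))
    simp only [conjSplitRegs_oracle] at h3
    exact h3
  obtain ⟨alg, ha, hb, hc⟩ := h2.exists_queryAlgorithm
    (Finset.univ.filter fun s => (e s.2.2).1 ≠ 0)
  refine ⟨alg, ha, hb, fun A => ?_⟩
  rw [hc]
  set z := conjSplitRegs e (W A * P) (EuclideanSpace.single 0 1)
  have hz : splitRegs e z = W A x₀ := by
    change splitRegs e ((splitRegs e).symm (W A (P (splitRegs e (EuclideanSpace.single 0 1))))) = _
    rw [LinearIsometryEquiv.apply_symm_apply, hP]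
  have hz1 : ‖z‖ ^ 2 = 1 := by
    rw [← (splitRegs e).norm_map z, hz, LinearIsometryEquiv.norm_map, hx₀, one_pow]
  have h0 : ‖W A x₀ 0‖ ^ 2 = ∑ s : QBasis n m w with ¬ (e s.2.2).1 ≠ 0, ‖z s‖ ^ 2 := by
    have hsplit : ∀ c, ‖W A x₀ c‖ ^ 2 = ∑ y, ∑ v, ∑ i, ‖z (i, v, e.symm (c, y))‖ ^ 2 := by
      intro c
      rw [← hz]
      simp only [norm_sq_block, splitRegs_apply]
    rw [hsplit, Finset.sum_filter, sum_splitRegs e, Finset.sum_eq_single (0 : γ)]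
    · simp
    · intro c _ hc; simp [hc]
    · simp
  rw [h0, ← hz1, norm_sq_block, ← Finset.sum_filter_add_sum_filter_not Finset.univ
    (fun s : QBasis n m w => (e s.2.2).1 ≠ 0) (fun s => ‖z s‖ ^ 2)]
  ring

end Bridge

/-! ### The Grover walk and its phase estimation as a query algorithm -/

section Walk

variable {n m : ℕ}

/-- The indicator of the valid indices. -/
noncomputable def idxVec (n : ℕ) : EuclideanSpace ℂ (BitVec (Nat.clog 2 n)) :=
  WithLp.toLp 2 fun i => if i.toNat < n then 1 else 0

/-- Minus the reflection about the uniform superposition of all indices. -/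
noncomputable def diffusion (n : ℕ) : EuclideanSpace ℂ (BitVec (Nat.clog 2 n)) ≃ₗᵢ[ℂ]
    EuclideanSpace ℂ (BitVec (Nat.clog 2 n)) :=
  LinearIsometryEquiv.neg ℂ * (Submodule.span ℂ {idxVec n}).reflection

/-- Flips the sign of the indices at which the array does not hold `v`. -/
noncomputable def valueSign (A : Fin n → Fin m) (v : BitVec (Nat.clog 2 m)) :
    EuclideanSpace ℂ (BitVec (Nat.clog 2 n)) ≃ₗᵢ[ℂ] EuclideanSpace ℂ (BitVec (Nat.clog 2 n)) :=
  blockDiag fun i => if oracleShift A i v = 0 then 1 else LinearIsometryEquiv.neg ℂ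

/-- The Grover walk that searches for the indices at which the array holds `v`. -/
noncomputable def walk (A : Fin n → Fin m) (v : BitVec (Nat.clog 2 m)) :
    EuclideanSpace ℂ (BitVec (Nat.clog 2 n)) ≃ₗᵢ[ℂ] EuclideanSpace ℂ (BitVec (Nat.clog 2 n)) :=
  diffusion n * valueSign A v

/-- The number of indices at which the array holds `v`. -/
def hitCount (A : Fin n → Fin m) (v : BitVec (Nat.clog 2 m)) : ℕ :=
  (Finset.univ.filter fun i : BitVec (Nat.clog 2 n) => oracleShift A i v = 0 ∧ i.toNat < n).card

/-- The uniform superposition of the indices, with value register zero. -/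
noncomputable def regInit (n m : ℕ) : QRegs n m :=
  WithLp.toLp 2 fun v => if v = 0 then (((√n)⁻¹ : ℝ) : ℂ) • idxVec n else 0

/-- The (unnormalized) superposition of the indices at which the array holds `v`. -/
noncomputable def hitVec (A : Fin n → Fin m) (v : BitVec (Nat.clog 2 m)) :
    EuclideanSpace ℂ (BitVec (Nat.clog 2 n)) :=
  WithLp.toLp 2 fun i => if oracleShift A i v = 0 ∧ i.toNat < n then 1 else 0

theorem regOracle_regInit (A : Fin n → Fin m) (v : BitVec (Nat.clog 2 m)) :
    regOracle A (regInit n m) v = (((√n)⁻¹ : ℝ) : ℂ) • hitVec A v := by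
  ext i
  rw [regOracle_apply]
  by_cases h : oracleShift A i v = 0#_ <;> simp [regInit, hitVec, idxVec, h]

theorem card_filter_toNat_lt (n : ℕ) :
    (Finset.univ.filter fun i : BitVec (Nat.clog 2 n) => i.toNat < n).card = n := by
  have hn : n ≤ 2 ^ Nat.clog 2 n := Nat.le_pow_clog (by norm_num) n
  conv_rhs => rw [← Finset.card_range n]
  refine Finset.card_nbij' (fun i => i.toNat) (fun i => BitVec.ofNat _ i) ?_ ?_ ?_ ?_
  · intro i hi; simpa using hi
  · intro i hi
    have hi' : i < n := by simpa using hi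
    simp [Nat.mod_eq_of_lt (hi'.trans_le hn), hi']
  · intro i _; simp
  · intro i hi
    have hi' : i < n := by simpa using hi
    simp [Nat.mod_eq_of_lt (hi'.trans_le hn)]

theorem norm_sq_idxVec (n : ℕ) : ‖idxVec n‖ ^ 2 = n := by
  rw [EuclideanSpace.norm_sq_eq]
  have h : ∀ i, ‖idxVec n i‖ ^ 2 = if i.toNat < n then (1 : ℝ) else 0 := by
    intro i; simp only [idxVec]; split_ifs <;> simp
  simp only [h, Finset.sum_boole, card_filter_toNat_lt]

theorem norm_sq_hitVec (A : Fin n → Fin m) (v : BitVec (Nat.clog 2 m)) :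
    ‖hitVec A v‖ ^ 2 = hitCount A v := by
  rw [EuclideanSpace.norm_sq_eq]
  have h : ∀ i, ‖hitVec A v i‖ ^ 2 =
      if oracleShift A i v = 0 ∧ i.toNat < n then (1 : ℝ) else 0 := by
    intro i; simp only [hitVec]; split_ifs <;> simp
  simp only [h, Finset.sum_boole, hitCount]

theorem inner_idxVec_hitVec (A : Fin n → Fin m) (v : BitVec (Nat.clog 2 m)) :
    inner ℂ (idxVec n) (hitVec A v) = (hitCount A v : ℂ) := by
  rw [PiLp.inner_apply]
  have h : ∀ i, inner ℂ (idxVec n i) (hitVec A v i) =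
      if oracleShift A i v = 0 ∧ i.toNat < n then (1 : ℂ) else 0 := by
    intro i
    by_cases h1 : i.toNat < n <;> by_cases h2 : oracleShift A i v = 0 <;>
      simp [idxVec, hitVec, h1, h2]
  simp only [h, Finset.sum_boole, hitCount]

theorem norm_regInit (hn : 1 ≤ n) : ‖regInit n m‖ = 1 := by
  have hn' : (0 : ℝ) < n := by exact_mod_cast hn
  refine norm_eq_of_sq_eq (norm_nonneg _) zero_le_one ?_
  rw [norm_sq_block, Finset.sum_eq_single 0]
  · simp only [regInit, if_true, norm_smul, mul_pow, norm_sq_idxVec]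
    rw [Complex.norm_real, Real.norm_eq_abs, sq_abs, inv_pow, Real.sq_sqrt hn'.le,
      inv_mul_cancel₀ hn'.ne', one_pow]
  · intro v _ hv
    have hv' : ¬ v = 0#_ := hv
    simp [regInit, hv']
  · simp

theorem diffusion_apply (x : EuclideanSpace ℂ (BitVec (Nat.clog 2 n))) :
    diffusion n x = x - (2 * (inner ℂ (idxVec n) x / n)) • idxVec n := by
  change -((Submodule.span ℂ {idxVec n}).reflection x) = _
  have h : ((‖idxVec n‖ : ℂ)) ^ 2 = n := by
    rw [← Complex.ofReal_pow, norm_sq_idxVec, Complex.ofReal_natCast]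
  have h2 := Submodule.reflection_singleton_apply (𝕜 := ℂ) (idxVec n) x
  rw [h2]
  simp only [Complex.coe_algebraMap] at *
  rw [h, neg_sub, mul_smul, two_smul ℂ, two_smul ℕ]

theorem diffusion_mul_self (n : ℕ) : diffusion n * diffusion n = 1 := by
  ext x : 1
  change -((Submodule.span ℂ {idxVec n}).reflection
    (-((Submodule.span ℂ {idxVec n}).reflection x))) = x
  rw [map_neg, neg_neg, Submodule.reflection_reflection]

theorem valueSign_apply (A : Fin n → Fin m) (v : BitVec (Nat.clog 2 m))
    (x : EuclideanSpace ℂ (BitVec (Nat.clog 2 n))) (i : BitVec (Nat.clog 2 n)) :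
    valueSign A v x i = if oracleShift A i v = 0 then x i else -x i := by
  rw [valueSign, blockDiag_apply]
  split_ifs <;> rfl

theorem valueSign_mul_self (A : Fin n → Fin m) (v : BitVec (Nat.clog 2 m)) :
    valueSign A v * valueSign A v = 1 := by
  ext x i
  change valueSign A v (valueSign A v x) i = x i
  rw [valueSign_apply, valueSign_apply]
  split_ifs <;> simp

/-- The sign flip `S` fixes the hit vector `χ` and sends the index vector `u` to `2χ - u`, while the
diffusion `D` sends `χ` to `χ - 2(h/n)u`, `h` being the hit count. In `D χ + S D χ` the multiples of
`u` cancel. -/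
theorem walk_hitVec (A : Fin n → Fin m) (v : BitVec (Nat.clog 2 m)) :
    walk A v (hitVec A v) + (walk A v)⁻¹ (hitVec A v) =
      ((2 - 4 * (hitCount A v / n : ℝ) : ℝ) : ℂ) • hitVec A v := by
  have h1 : valueSign A v (hitVec A v) = hitVec A v := by
    ext i
    rw [valueSign_apply]
    by_cases h : oracleShift A i v = 0#_ <;> simp [hitVec, h]
  have h2 : (walk A v)⁻¹ = valueSign A v * diffusion n := by
    rw [walk, mul_inv_rev, inv_eq_of_mul_eq_one_left (diffusion_mul_self n),
      inv_eq_of_mul_eq_one_left (valueSign_mul_self A v)]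
  have h3 : valueSign A v (idxVec n) = (2 : ℂ) • hitVec A v - idxVec n := by
    ext i
    rw [valueSign_apply]
    by_cases h : oracleShift A i v = 0#_ <;> by_cases h' : i.toNat < n <;>
      simp [hitVec, idxVec, h, h']
    norm_num
  rw [h2]
  change diffusion n (valueSign A v (hitVec A v)) + valueSign A v (diffusion n (hitVec A v)) = _
  rw [h1, diffusion_apply, inner_idxVec_hitVec, map_sub, map_smul, h1, h3]
  push_cast
  module

/-- Flips the sign unless the value register is zero. -/
noncomputable def zeroSign (n m : ℕ) : QRegs n m ≃ₗᵢ[ℂ] QRegs n m :=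
  blockDiag fun v => if v = 0 then 1 else LinearIsometryEquiv.neg ℂ

/-- Querying turns "the array holds `v` at `i`" into "the value register is zero"; the second query
restores `v`. Each walk step thus costs two queries. -/
theorem regOracle_zeroSign_regOracle (A : Fin n → Fin m) :
    regOracle A * (zeroSign n m * regOracle A) = blockDiag (valueSign A) := by
  ext x v i
  change regOracle A (zeroSign n m (regOracle A x)) v i = _
  rw [regOracle_apply, zeroSign, blockDiag_apply, blockDiag_apply, valueSign_apply]
  split_ifs with h
  · change regOracle A x (oracleShift A i v) i = _
    rw [regOracle_apply, oracleShift_oracleShift]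
  · change -(regOracle A x (oracleShift A i v) i) = _
    rw [regOracle_apply, oracleShift_oracleShift]

variable {M : ℕ} [NeZero M]

/-- The first `s` steps of the powers of the walk, controlled by the clock. -/
noncomputable def controlledWalk (M : ℕ) [NeZero M] (A : Fin n → Fin m) (s : ℕ) :
    PiLp 2 (fun _ : ZMod M => QRegs n m) ≃ₗᵢ[ℂ] PiLp 2 (fun _ : ZMod M => QRegs n m) :=
  blockDiag fun j => blockDiag (walk A) ^ min j.val s

/-- Oracle calls cannot be controlled, so only the fixed unitaries between them depend on the clock.
-/
theorem queryImpl_controlledWalk (s : ℕ) :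
    QueryImpl (fun A : Fin n → Fin m => blockConst (ZMod M) (regOracle A)) (2 * s)
      fun A => controlledWalk M A s := by
  induction s with
  | zero =>
    refine (QueryImpl.const 1).of_eq rfl fun A => ?_
    simp only [controlledWalk, Nat.min_zero, pow_zero]
    exact (map_one (blockDiag (ι := ZMod M) (H := QRegs n m))).symm
  | succ s ih =>
    refine ((ih.step (blockDiag fun j => if s < j.val then zeroSign n m else 1)).step
      (blockDiag fun j => if s < j.val then blockConst _ (diffusion n) else 1)).of_eq rfl
      fun A => ?_
    change blockDiag _ * (blockDiag (fun _ => regOracle A) * (blockDiag _ *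
      (blockDiag (fun _ => regOracle A) * blockDiag _))) = blockDiag _
    rw [← map_mul, ← map_mul, ← map_mul, ← map_mul]
    congr 1
    funext j
    simp only [Pi.mul_apply]
    split_ifs with h
    · have hwalk : blockDiag (walk A) =
          blockConst _ (diffusion n) * (regOracle A * (zeroSign n m * regOracle A)) := by
        rw [regOracle_zeroSign_regOracle, blockConst, MonoidHom.comp_apply, ← map_mul]
        rfl
      rw [Nat.min_eq_right h.le, Nat.min_eq_right h, pow_succ', hwalk]
      simp only [mul_assoc]
    -- On clock values that have finished their steps the fixed unitaries are trivial and the two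
    -- oracle calls cancel.
    · rw [Nat.min_eq_left (by omega), Nat.min_eq_left (by omega), one_mul, one_mul, ← mul_assoc,
        regOracle_mul_self, one_mul]

/-- Phase estimation of the walks for the value at a random index. -/
noncomputable def estimation (M : ℕ) [NeZero M] (A : Fin n → Fin m) :
    PiLp 2 (fun _ : ZMod M => QRegs n m) ≃ₗᵢ[ℂ] PiLp 2 (fun _ : ZMod M => QRegs n m) :=
  clockFourier * (controlledWalk M A M * blockConst (ZMod M) (regOracle A))

theorem queryImpl_estimation :
    QueryImpl (fun A : Fin n → Fin m => blockConst (ZMod M) (regOracle A)) (2 * M + 1)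
      fun A => estimation M A :=
  ((queryImpl_controlledWalk M).mul QueryImpl.oracle).const_mul _

/-- The initial state of phase estimation. -/
noncomputable def estimationInit (n m M N r : ℕ) [NeZero M] :
    PiLp 2 (fun _ : ZMod M => QRegs n m) :=
  WithLp.toLp 2 fun j => clockAmp N r j.val • regInit n m

theorem norm_estimationInit (hn : 1 ≤ n) {N r : ℕ} (hN : 0 < N) (hM : (r + 1) * N ≤ M) :
    ‖estimationInit n m M N r‖ = 1 := by
  refine norm_eq_of_sq_eq (norm_nonneg _) zero_le_one ?_
  rw [norm_sq_block, one_pow, ← sum_norm_sq_clockAmp (M := M) hN hM]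
  simp only [estimationInit, norm_smul, norm_regInit hn, mul_one]

theorem blockDiag_pow_apply {ι H : Type*} [Fintype ι] [NormedAddCommGroup H]
    [InnerProductSpace ℂ H] (e : ι → (H ≃ₗᵢ[ℂ] H)) (k : ℕ) (x : PiLp 2 (fun _ : ι => H)) (i : ι) :
    (blockDiag e ^ k) x i = (e i ^ k) (x i) := by
  rw [← map_pow, blockDiag_apply, Pi.pow_apply]

/-- The value register is never changed after the first query, so each value `v` undergoes its own
phase estimation. -/
theorem estimation_estimationInit (A : Fin n → Fin m) (N r : ℕ) (y : ZMod M)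
    (v : BitVec (Nat.clog 2 m)) : estimation M A (estimationInit n m M N r) y v =
      phaseState M N r (walk A v) ((((√n)⁻¹ : ℝ) : ℂ) • hitVec A v) y := by
  change clockFourier (controlledWalk M A M (blockConst (ZMod M) (regOracle A)
    (estimationInit n m M N r))) y v = _
  rw [clockFourier_apply, phaseState, PiLp.smul_apply]
  congr 1
  rw [WithLp.ofLp_sum, Finset.sum_apply]
  refine Finset.sum_congr rfl fun j _ => ?_
  rw [PiLp.smul_apply]
  congr 1
  rw [controlledWalk, blockDiag_apply, Nat.min_eq_left (ZMod.val_lt j).le, blockDiag_pow_apply,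
    blockConst_apply, ← regOracle_regInit]
  simp only [estimationInit, map_smul, PiLp.smul_apply]

/-- The probability that phase estimation ends in `Y`. -/
noncomputable def estimationProb (M N r : ℕ) [NeZero M] (Y : Finset (ZMod M))
    (A : Fin n → Fin m) : ℝ :=
  ∑ y ∈ Y, ∑ v, ‖phaseState M N r (walk A v) ((((√n)⁻¹ : ℝ) : ℂ) • hitVec A v) y‖ ^ 2

theorem card_bitVec (w : ℕ) : Fintype.card (BitVec w) = 2 ^ w :=
  (Fintype.card_congr ⟨BitVec.toFin, BitVec.ofFin, fun _ => rfl, fun _ => rfl⟩).trans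
    (Fintype.card_fin _)

theorem queryImpl_testRound {C : ℕ} [NeZero C] (Y : Finset (ZMod M))
    (v₀ : PiLp 2 (fun _ : ZMod M => QRegs n m)) :
    QueryImpl (fun A : Fin n → Fin m => blockConst (ZMod C) (blockConst (ZMod M) (regOracle A)))
      (2 * (2 * M + 1)) fun A => testRound (M := C) (estimation M A) Y v₀ := by
  have hq := (queryImpl_estimation (n := n) (m := m) (M := M)).map (blockConst (ZMod C))
  have hq' := ((queryImpl_estimation (n := n) (m := m) (M := M)).inv fun A => by
    rw [← map_mul, regOracle_mul_self, map_one]).map (blockConst (ZMod C))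
  have h := (hq'.mul (hq.const_mul (flagIncr (vanishingOn (ZMod M) (QRegs n m) Y)))).const_mul
    (flagIncr (Submodule.span ℂ {v₀}))
  refine h.of_eq (by ring) fun A => ?_
  rw [testRound]

theorem norm_sq_testRound_pow (hn : 1 ≤ n) {C N r R : ℕ} [NeZero C] (hN : 0 < N)
    (hM : (r + 1) * N ≤ M) (hR : 2 * R < C) (Y : Finset (ZMod M)) (A : Fin n → Fin m) :
    ‖(testRound (M := C) (estimation M A) Y (estimationInit n m M N r) ^ R)
      (PiLp.single 2 0 (estimationInit n m M N r)) 0‖ ^ 2 =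
        ((1 - estimationProb M N r Y A) ^ R) ^ 2 := by
  have hv₀ : ‖estimationInit n m M N r‖ = 1 := norm_estimationInit hn hN hM
  have hslice : CounterSlice 0 (estimationInit n m M N r)
      (PiLp.single 2 (0 : ZMod C) (estimationInit n m M N r)) := by
    refine ⟨PiLp.single_eq_same _ _ _, fun i hi => PiLp.single_eq_of_ne _ ?_ _⟩
    rintro rfl
    simp at hi
  rw [(counterSlice_testRound_pow (W := estimation M A) (Y := Y) hv₀ hslice R hR).1,
    norm_smul, hv₀, mul_one, Complex.norm_real, Real.norm_eq_abs, sq_abs, estimationProb]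
  simp only [norm_sq_block _, ← estimation_estimationInit]

/-- `R` postselected rounds of phase estimation, as a query algorithm. -/
theorem exists_estimationAlgorithm (hn : 1 ≤ n) {b c N r R : ℕ} (hN : 0 < N)
    (hM : (r + 1) * N ≤ 2 ^ b) (hR : 2 * R < 2 ^ c) (Y : Finset (ZMod (2 ^ b))) :
    ∃ alg : QueryAlgorithm n m, alg.numQueries = R * (2 * (2 * 2 ^ b + 1)) ∧
      alg.numQubits = Nat.clog 2 n + Nat.clog 2 m + (b + c) ∧
      ∀ A, alg.acceptProb A = 1 - ((1 - estimationProb (2 ^ b) N r Y A) ^ R) ^ 2 := by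
  have e : BitVec (b + c) ≃ ZMod (2 ^ c) × ZMod (2 ^ b) := Fintype.equivOfCardEq (by
    rw [card_bitVec, Fintype.card_prod, ZMod.card, ZMod.card, pow_add, mul_comm])
  have hx₀ : ‖(PiLp.single 2 0 (estimationInit n m (2 ^ b) N r) :
      PiLp 2 (fun _ : ZMod (2 ^ c) => PiLp 2 (fun _ : ZMod (2 ^ b) => QRegs n m)))‖ = 1 := by
    rw [PiLp.norm_single, norm_estimationInit hn hN hM]
  obtain ⟨alg, h1, h2, h3⟩ :=
    ((queryImpl_testRound Y (estimationInit n m (2 ^ b) N r)).pow R).exists_counterAlgorithm e hx₀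
  exact ⟨alg, h1, h2, fun A => by rw [h3, norm_sq_testRound_pow hn hN hM hR]⟩

end Walk

/-! ### Acceptance probabilities and correctness -/

section Probability

variable {n m : ℕ} {M : ℕ} [NeZero M]

theorem oracleShift_eq_zero_iff (A : Fin n → Fin m) {i : BitVec (Nat.clog 2 n)}
    (hi : i.toNat < n) (v : BitVec (Nat.clog 2 m)) :
    oracleShift A i v = 0 ↔ v = BitVec.ofNat _ (A ⟨i.toNat, hi⟩).val := by
  rw [oracleShift, dif_pos hi]
  exact BitVec.xor_eq_zero_iff

theorem ofNat_clog_injective (m : ℕ) :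
    Function.Injective fun a : Fin m => BitVec.ofNat (Nat.clog 2 m) a.val := by
  intro a a' h
  have hm : m ≤ 2 ^ Nat.clog 2 m := Nat.le_pow_clog (by norm_num) m
  have h' := congrArg BitVec.toNat h
  simp only [BitVec.toNat_ofNat] at h'
  rw [Nat.mod_eq_of_lt (a.2.trans_le hm), Nat.mod_eq_of_lt (a'.2.trans_le hm)] at h'
  exact Fin.ext h'

theorem hitCount_ofNat (A : Fin n → Fin m) (a : Fin m) :
    hitCount A (BitVec.ofNat _ a.val) = (Finset.univ.filter fun i => A i = a).card := by
  have hn : n ≤ 2 ^ Nat.clog 2 n := Nat.le_pow_clog (by norm_num) n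
  have hto : ∀ i : Fin n, (BitVec.ofNat (Nat.clog 2 n) i.val).toNat = i.val := fun i => by
    rw [BitVec.toNat_ofNat, Nat.mod_eq_of_lt (i.2.trans_le hn)]
  symm
  refine Finset.card_bij (fun i _ => BitVec.ofNat _ i.val) ?_ ?_ ?_
  · intro i hi
    have hi' : A i = a := by simpa using hi
    have hlt : (BitVec.ofNat (Nat.clog 2 n) i.val).toNat < n := by rw [hto]; exact i.2
    refine Finset.mem_filter.2 ⟨Finset.mem_univ _, (oracleShift_eq_zero_iff A hlt _).2 ?_, hlt⟩
    simp only [hto, hi']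
  · intro i _ j _ h
    exact ofNat_clog_injective n h
  · intro j hj
    obtain ⟨h1, h2⟩ := (Finset.mem_filter.1 hj).2
    refine ⟨⟨j.toNat, h2⟩, ?_, by simp⟩
    have := ofNat_clog_injective m ((oracleShift_eq_zero_iff A h2 _).1 h1)
    simp [this]

theorem hitCount_le {A : Fin n → Fin m} {x : ℝ} (hx : 0 ≤ x)
    (h : ∀ a, ((Finset.univ.filter fun i => A i = a).card : ℝ) ≤ x) (v : BitVec (Nat.clog 2 m)) :
    (hitCount A v : ℝ) ≤ x := by
  by_cases h0 : ∃ i : BitVec (Nat.clog 2 n), oracleShift A i v = 0 ∧ i.toNat < n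
  · obtain ⟨i, h1, h2⟩ := h0
    rw [(oracleShift_eq_zero_iff A h2 v).1 h1, hitCount_ofNat]
    exact h _
  -- Bit strings that encode no array entry have no hits.
  · have : hitCount A v = 0 := by
      rw [hitCount, Finset.card_eq_zero, Finset.filter_eq_empty_iff]
      intro i _ hi
      exact h0 ⟨i, hi⟩
    rw [this, Nat.cast_zero]
    exact hx

theorem norm_sq_smul_hitVec (A : Fin n → Fin m) (v : BitVec (Nat.clog 2 m)) :
    ‖(((√n)⁻¹ : ℝ) : ℂ) • hitVec A v‖ ^ 2 = hitCount A v / n := by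
  rw [norm_smul, mul_pow, norm_sq_hitVec, Complex.norm_real, Real.norm_eq_abs, sq_abs, inv_pow,
    Real.sq_sqrt (Nat.cast_nonneg n), div_eq_inv_mul]

theorem sum_norm_sq_smul_hitVec (hn : 1 ≤ n) (A : Fin n → Fin m) :
    ∑ v, ‖(((√n)⁻¹ : ℝ) : ℂ) • hitVec A v‖ ^ 2 = 1 := by
  simp only [← regOracle_regInit]
  rw [← norm_sq_block, LinearIsometryEquiv.norm_map, norm_regInit hn, one_pow]

theorem walk_smul_hitVec (A : Fin n → Fin m) (v : BitVec (Nat.clog 2 m)) (a : ℂ) :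
    walk A v (a • hitVec A v) + (walk A v)⁻¹ (a • hitVec A v) =
      ((2 - 4 * (hitCount A v / n : ℝ) : ℝ) : ℂ) • a • hitVec A v := by
  rw [map_smul, map_smul, ← smul_add, walk_hitVec, smul_comm]

/-- Outcomes of phase estimation above the threshold `t`. -/
noncomputable def highOutcomes (M : ℕ) [NeZero M] (t : ℝ) : Finset (ZMod M) :=
  open Classical in Finset.univ.filter fun y => t ≤ ‖1 - (ZMod.stdAddChar y : ℂ)‖

theorem estimationProb_le_one (hn : 1 ≤ n) {N r : ℕ} (hN : 0 < N) (hM : (r + 1) * N ≤ M)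
    (Y : Finset (ZMod M)) (A : Fin n → Fin m) : estimationProb M N r Y A ≤ 1 := by
  rw [estimationProb, Finset.sum_comm, ← sum_norm_sq_smul_hitVec hn A]
  refine Finset.sum_le_sum fun v _ => ?_
  rw [← sum_norm_sq_phaseState hN hM (walk A v)]
  exact Finset.sum_le_sum_of_subset_of_nonneg (Finset.subset_univ _) fun _ _ _ => by positivity

/-- Every value has phase at least `g` below the threshold, so the tail bound applies to all of them
and their weights sum to one. -/
theorem estimationProb_le (hn : 1 ≤ n) {N r : ℕ} (hN : 0 < N) (hM : (r + 1) * N ≤ M)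
    {t g x : ℝ} (hg : 0 < g) (hgN : 4 ≤ g * N) {A : Fin n → Fin m}
    (hx : ∀ v, (hitCount A v : ℝ) ≤ x) (ht : 2 * √(x / n) + g ≤ t) :
    estimationProb M N r (highOutcomes M t) A ≤ (1 / 2) ^ r := by
  rw [estimationProb, Finset.sum_comm]
  calc _ ≤ ∑ v, (1 / 2 : ℝ) ^ r * ‖(((√n)⁻¹ : ℝ) : ℂ) • hitVec A v‖ ^ 2 := by
        refine Finset.sum_le_sum fun v _ => ?_
        refine sum_norm_sq_phaseState_le hN hM (s := hitCount A v / n) (by positivity) hg hgN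
          (walk_smul_hitVec A v _) _ fun y hy => ?_
        have hy' : t ≤ ‖1 - (ZMod.stdAddChar y : ℂ)‖ := by
          simpa [highOutcomes] using hy
        have h1 : √((hitCount A v : ℝ) / n) ≤ √(x / n) :=
          Real.sqrt_le_sqrt (div_le_div_of_nonneg_right (hx v) (Nat.cast_nonneg n))
        exact le_trans (by linarith) (le_abs_self _)
    _ = _ := by rw [← Finset.mul_sum, sum_norm_sq_smul_hitVec hn, mul_one]

/-- The single value `v` already suffices: it is drawn with probability at least `x/n`, and the tail
bound applies to the low outcomes. -/
theorem le_estimationProb {N r : ℕ} (hN : 0 < N) (hM : (r + 1) * N ≤ M)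
    {t g x : ℝ} (hg : 0 < g) (hgN : 4 ≤ g * N) {A : Fin n → Fin m} {v : BitVec (Nat.clog 2 m)}
    (hx : x ≤ hitCount A v) (ht : t + g ≤ 2 * √(x / n)) :
    (1 - (1 / 2) ^ r) * (x / n) ≤ estimationProb M N r (highOutcomes M t) A := by
  classical
  set χ := (((√n)⁻¹ : ℝ) : ℂ) • hitVec A v with hχ
  have h1 : √(x / n) ≤ √((hitCount A v : ℝ) / n) :=
    Real.sqrt_le_sqrt (div_le_div_of_nonneg_right hx (Nat.cast_nonneg n))
  have hlow : ∑ y ∈ (highOutcomes M t)ᶜ, ‖phaseState M N r (walk A v) χ y‖ ^ 2 ≤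
      (1 / 2) ^ r * ‖χ‖ ^ 2 := by
    refine sum_norm_sq_phaseState_le hN hM (s := hitCount A v / n) (by positivity) hg hgN
      (walk_smul_hitVec A v _) _ fun y hy => ?_
    have hy' : ‖1 - (ZMod.stdAddChar y : ℂ)‖ < t := by
      simpa [highOutcomes] using hy
    rw [abs_sub_comm]
    exact le_trans (by linarith) (le_abs_self _)
  have hall := sum_norm_sq_phaseState hN hM (walk A v) χ
  rw [← Finset.sum_add_sum_compl (highOutcomes M t)] at hall
  have hle : ∑ y ∈ highOutcomes M t, ‖phaseState M N r (walk A v) χ y‖ ^ 2 ≤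
      estimationProb M N r (highOutcomes M t) A := by
    rw [estimationProb]
    exact Finset.sum_le_sum fun y _ => Finset.single_le_sum
      (f := fun v => ‖phaseState M N r (walk A v) ((((√n)⁻¹ : ℝ) : ℂ) • hitVec A v) y‖ ^ 2)
      (fun _ _ => by positivity) (Finset.mem_univ v)
  have hn : x / n ≤ ‖χ‖ ^ 2 := by
    rw [hχ, norm_sq_smul_hitVec]
    exact div_le_div_of_nonneg_right hx (Nat.cast_nonneg n)
  have hr : (0 : ℝ) ≤ 1 - (1 / 2) ^ r := by
    have : (1 / 2 : ℝ) ^ r ≤ 1 := pow_le_one₀ (by norm_num) (by norm_num)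
    linarith
  calc (1 - (1 / 2 : ℝ) ^ r) * (x / n) ≤ (1 - (1 / 2) ^ r) * ‖χ‖ ^ 2 := by gcongr
    _ ≤ _ := by linarith

/-- Correctness and exact cost of the algorithm in terms of its parameters. -/
theorem exists_solves {k b c N r R : ℕ} {Δ Δ' δ g : ℝ} (hn : 1 ≤ n) (hk : 1 ≤ k)
    (hΔ : 0 < Δ) (hΔ' : Δ' = max Δ 1) (hΔk : Δ ≤ k) (hδ : 0 < δ)
    (hg : g = (√k - √(k - Δ')) / √n) (hg0 : 0 < g) (hgN : 4 ≤ g * N)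
    (hN : 0 < N) (hM : (r + 1) * N ≤ 2 ^ b) (hR : 2 * R < 2 ^ c) (hr : 1 ≤ r)
    (hrR : 2 * R ≤ δ * 2 ^ r) (hRδ : n / k * Real.log (1 / δ) ≤ R) :
    ∃ alg : QueryAlgorithm n m, SolvesGappedKDistinctness alg k Δ δ ∧
      alg.numQueries = R * (2 * (2 * 2 ^ b + 1)) ∧
      alg.numQubits = Nat.clog 2 n + Nat.clog 2 m + (b + c) := by
  have hn' : (0 : ℝ) < n := by exact_mod_cast hn
  have hk' : (0 : ℝ) < k := by exact_mod_cast hk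
  have hk1 : (1 : ℝ) ≤ k := by exact_mod_cast hk
  have hΔ'k : Δ' ≤ k := by rw [hΔ']; exact max_le hΔk hk1
  -- The threshold is the midpoint of `2√(k/n)` and `2√((k-Δ')/n)`; `g` is half their distance.
  obtain ⟨alg, h1, h2, h3⟩ := exists_estimationAlgorithm (m := m) hn hN hM hR
    (highOutcomes (2 ^ b) ((√(k - Δ') + √k) / √n))
  refine ⟨alg, fun A => ⟨fun hA => ?_, fun hA => ?_⟩, h1, h2⟩
  · obtain ⟨S, hS, hSA⟩ := hA
    have hne : S.Nonempty := Finset.card_pos.1 (by omega)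
    obtain ⟨i₀, hi₀⟩ := hne
    have hcount : (k : ℝ) ≤ hitCount A (BitVec.ofNat _ (A i₀).val) := by
      rw [hitCount_ofNat, ← hS]
      exact_mod_cast Finset.card_le_card fun i hi => by simp [hSA i hi i₀ hi₀]
    have hp := le_estimationProb (M := 2 ^ b) (t := (√(k - Δ') + √k) / √n) hN hM hg0 hgN hcount (by
      rw [hg, Real.sqrt_div hk'.le, ← add_div]
      apply le_of_eq
      ring)
    have hp1 := estimationProb_le_one (M := 2 ^ b) hn hN hM
      (highOutcomes (2 ^ b) ((√(k - Δ') + √k) / √n)) A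
    rw [h3]
    set p := estimationProb (2 ^ b) N r (highOutcomes (2 ^ b) ((√(k - Δ') + √k) / √n)) A
    have hr2 : (1 / 2 : ℝ) ^ r ≤ 1 / 2 := by
      calc (1 / 2 : ℝ) ^ r ≤ (1 / 2) ^ 1 :=
            pow_le_pow_of_le_one (by norm_num) (by norm_num) hr
        _ = _ := by norm_num
    have hp2 : (k : ℝ) / n / 2 ≤ p := by
      have : (0 : ℝ) < k / n := by positivity
      nlinarith
    -- As `p ≥ k/(2n)`, all rounds miss with probability at most `exp (-2Rp) ≤ exp (-Rk/n)`.
    have h4 : ((1 - p) ^ R) ^ 2 ≤ δ := by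
      calc ((1 - p) ^ R) ^ 2 = (1 - p) ^ (2 * R) := by rw [← pow_mul, mul_comm]
        _ ≤ (Real.exp (-p)) ^ (2 * R) :=
            pow_le_pow_left₀ (by linarith) (Real.one_sub_le_exp_neg p) _
        _ = Real.exp (-(2 * R * p)) := by
            rw [← Real.exp_nat_mul]; push_cast; ring_nf
        _ ≤ Real.exp (-Real.log (1 / δ)) := by
            apply Real.exp_le_exp.2
            have h5 : Real.log (1 / δ) ≤ R * (k / n) := by
              have := mul_le_mul_of_nonneg_right hRδ (by positivity : (0 : ℝ) ≤ k / n)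
              calc Real.log (1 / δ) = n / k * Real.log (1 / δ) * (k / n) := by field_simp
                _ ≤ _ := this
            have h6 : (R : ℝ) * (k / n / 2) ≤ R * p := by gcongr
            linarith
        _ = δ := by
            rw [one_div, Real.log_inv, neg_neg, Real.exp_log hδ]
    linarith
  · have hfreq : ∀ a : Fin m, ((Finset.univ.filter fun i => A i = a).card : ℝ) ≤ k - Δ' := by
      intro a
      have h4 := hA a
      rw [hΔ']
      -- A frequency below `k` is at most `k - 1`, so a gap smaller than `1` is a gap of `1`.
      rcases le_total Δ 1 with h5 | h5
      · rw [max_eq_right h5]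
        have h6 : ((Finset.univ.filter fun i => A i = a).card : ℝ) < k := by linarith
        have h7 : (Finset.univ.filter fun i => A i = a).card + 1 ≤ k := by exact_mod_cast h6
        have h8 : ((Finset.univ.filter fun i => A i = a).card : ℝ) + 1 ≤ k := by exact_mod_cast h7
        linarith
      · rwa [max_eq_left h5]
    have hp := estimationProb_le (M := 2 ^ b) (t := (√(k - Δ') + √k) / √n) hn hN hM hg0 hgN
      (hitCount_le (sub_nonneg.2 hΔ'k) hfreq) (by
        rw [hg, Real.sqrt_div (sub_nonneg.2 hΔ'k)]
        apply le_of_eq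
        ring)
    rw [h3]
    set p := estimationProb (2 ^ b) N r (highOutcomes (2 ^ b) ((√(k - Δ') + √k) / √n)) A
    have hr1 : (1 / 2 : ℝ) ^ r ≤ 1 := pow_le_one₀ (by norm_num) (by norm_num)
    -- Bernoulli's inequality; `r` is chosen so that `2R` errors of size `2^{-r}` stay below `δ`.
    have h4 : 1 - 2 * R * p ≤ ((1 - p) ^ R) ^ 2 := by
      have := one_add_mul_le_pow (a := -p) (by linarith) (2 * R)
      calc 1 - 2 * R * p = 1 + ((2 * R : ℕ) : ℝ) * -p := by push_cast; ring
        _ ≤ (1 + -p) ^ (2 * R) := this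
        _ = _ := by rw [← sub_eq_add_neg, ← pow_mul, mul_comm]
    have hp0 : 0 ≤ p := Finset.sum_nonneg fun _ _ => Finset.sum_nonneg fun _ _ => by positivity
    have h5 : 2 * R * p ≤ δ := by
      calc 2 * R * p ≤ (δ * 2 ^ r) * (1 / 2) ^ r := by gcongr
        _ = δ := by rw [mul_assoc, ← mul_pow]; norm_num
    linarith

end Probability

/-! ### Choice of parameters and cost bounds -/

theorem two_pow_clog_le {x : ℕ} (hx : 1 ≤ x) : 2 ^ Nat.clog 2 x ≤ 2 * x := by
  rcases hx.eq_or_lt with rfl | hx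
  · simp
  · have h := Nat.pow_pred_clog_lt_self (b := 2) (by norm_num) hx
    have h2 : 0 < Nat.clog 2 x := Nat.clog_pos (by norm_num) hx
    obtain ⟨j, hj⟩ := Nat.exists_eq_succ_of_ne_zero h2.ne'
    rw [hj] at h ⊢
    rw [Nat.succ_eq_add_one, pow_succ]
    simp at h
    omega

theorem le_two_mul_log {j : ℕ} {x : ℝ} (h : (2 : ℝ) ^ j ≤ x) : (j : ℝ) ≤ 2 * Real.log x := by
  have h1 := Real.log_le_log (by positivity) h
  rw [Real.log_pow] at h1
  have := Real.log_two_gt_d9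
  nlinarith [Nat.cast_nonneg (α := ℝ) j]

theorem clog_le_log {x : ℕ} (hx : 1 ≤ x) : (Nat.clog 2 x : ℝ) ≤ 4 * Real.log x := by
  rcases hx.eq_or_lt with rfl | hx
  · simp
  · have h : ((2 : ℝ) ^ Nat.clog 2 x) ≤ (x : ℝ) ^ 2 := by
      have h1 := two_pow_clog_le hx.le
      have h2 : 2 ^ Nat.clog 2 x ≤ x ^ 2 := by nlinarith
      exact_mod_cast h2
    have h3 := le_two_mul_log h
    rw [Real.log_pow] at h3
    push_cast at h3
    linarith

theorem log_le_of_le_mul {x a y z : ℝ} {j : ℕ} (hx : 0 < x) (ha : 0 < a) (haj : a ≤ 2 ^ j)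
    (hy : 0 < y) (hz : 0 < z) (h : x ≤ a * y * z) :
    Real.log x ≤ j + y + Real.log z := by
  have h1 := Real.log_le_log hx h
  rw [Real.log_mul (by positivity) hz.ne', Real.log_mul ha.ne' hy.ne'] at h1
  have h2 := Real.log_le_log ha haj
  rw [Real.log_pow] at h2
  have h3 := Real.log_le_sub_one_of_pos hy
  have h4 : (j : ℝ) * Real.log 2 ≤ j := by
    have := Real.log_two_lt_d9
    nlinarith [Nat.cast_nonneg (α := ℝ) j]
  linarith

theorem exists_boxLength {D t g : ℝ} (hD : 0 < D) (ht : D ≤ t) (hg : D / (2 * t) ≤ g) :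
    ∃ N : ℕ, 4 ≤ g * N ∧ 0 < N ∧ (N : ℝ) ≤ 9 * t / D := by
  have ht0 : 0 < t := hD.trans_le ht
  have hg0 : 0 < g := lt_of_lt_of_le (by positivity) hg
  refine ⟨⌈4 / g⌉₊, ?_, Nat.ceil_pos.2 (by positivity), ?_⟩
  · have := Nat.le_ceil (4 / g)
    rwa [div_le_iff₀ hg0, mul_comm] at this
  · have h1 := (Nat.ceil_lt_add_one (by positivity : 0 ≤ 4 / g)).le
    have h2 : 4 / g ≤ 8 * t / D := by
      rw [div_le_div_iff₀ hg0 hD]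
      rw [div_le_iff₀ (by positivity)] at hg
      linarith
    have h3 : 1 ≤ t / D := (one_le_div hD).2 ht
    have h4 : 9 * t / D = 8 * t / D + t / D := by ring
    linarith

theorem exists_rounds {q L l : ℝ} (hq : 1 ≤ q) (hL : 0 < L) (hLl : L ≤ l) (hl : 1 ≤ 2 * l) :
    ∃ R : ℕ, 1 ≤ R ∧ q * L ≤ R ∧ (R : ℝ) ≤ 3 * q * l := by
  have hpos : 0 < q * L := mul_pos (by linarith) hL
  refine ⟨⌈q * L⌉₊, Nat.ceil_pos.2 hpos, Nat.le_ceil _, ?_⟩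
  have h1 := (Nat.ceil_lt_add_one hpos.le).le
  have h2 : q * L ≤ q * l := mul_le_mul_of_nonneg_left hLl (by linarith)
  have h3 : 1 ≤ q * (2 * l) := one_le_mul_of_one_le_of_one_le hq hl
  linarith

theorem exists_order {q δ l : ℝ} {R : ℕ} (hR : 1 ≤ R) (hδ : 0 < δ) (hδ2 : δ < 1 / 2)
    (hl : Real.log 2 ≤ l) (hexp : Real.exp l = q / δ) (hRq : (R : ℝ) ≤ 3 * q * l) :
    ∃ r : ℕ, 1 ≤ r ∧ 2 * R ≤ δ * 2 ^ r ∧ (r : ℝ) + 1 ≤ 20 * l := by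
  have hlog2 := Real.log_two_gt_d9
  have hl0 : 0 < l := by linarith
  have hR1 : (1 : ℝ) ≤ R := by exact_mod_cast hR
  have hx4 : (4 : ℝ) ≤ 2 * R / δ := by rw [le_div_iff₀ hδ]; linarith
  obtain ⟨x, hxge, hxle⟩ : ∃ x : ℕ, 2 * R / δ ≤ x ∧ (x : ℝ) ≤ 2 * R / δ + 1 :=
    ⟨⌈2 * R / δ⌉₊, Nat.le_ceil _, (Nat.ceil_lt_add_one (by positivity)).le⟩
  have hx1 : 4 ≤ x := by exact_mod_cast hx4.trans hxge
  have hrx : (x : ℝ) ≤ 2 ^ Nat.clog 2 x := by exact_mod_cast Nat.le_pow_clog (by norm_num) x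
  refine ⟨Nat.clog 2 x, Nat.clog_pos (by norm_num) (by omega), ?_, ?_⟩
  · have h1 := hxge.trans hrx
    rwa [div_le_iff₀ hδ, mul_comm _ δ] at h1
  · have h2 : (2 : ℝ) ^ Nat.clog 2 x ≤ 2 * x := by
      exact_mod_cast two_pow_clog_le (by omega : 1 ≤ x)
    -- `2x ≤ 4R/δ + 2 ≤ 6R/δ`, and `R ≤ 3ql`.
    have h3 : (2 : ℝ) ^ Nat.clog 2 x ≤ 18 * l * Real.exp l := by
      rw [hexp]
      have h4 : 1 ≤ R / δ := by rw [le_div_iff₀ hδ]; linarith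
      have h5 : 2 * R / δ = 2 * (R / δ) := by ring
      have h6 : R / δ ≤ 3 * q * l / δ := div_le_div_of_nonneg_right hRq hδ.le
      have h7 : 18 * l * (q / δ) = 6 * (3 * q * l / δ) := by ring
      linarith
    have h4 := le_two_mul_log h3
    have h5 := log_le_of_le_mul (j := 5) (by positivity : 0 < 18 * l * Real.exp l)
      (by norm_num) (by norm_num) hl0 (Real.exp_pos l) le_rfl
    rw [Real.log_exp] at h5
    push_cast at h5
    -- This gives `r + 1 ≤ 11 + 4l`, which is at most `20l` since `l ≥ log 2 > 11/16`.
    linarith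

/-- Rationalise `√k - √(k - D) = D / (√k + √(k - D))` and bound the denominator by `2√k`. -/
theorem div_le_sqrt_gap {k n D : ℝ} (hk : 0 < k) (hn : 0 < n) (hD : 0 ≤ D) (hDk : D ≤ k) :
    D / (2 * (√k * √n)) ≤ (√k - √(k - D)) / √n := by
  have hk0 : 0 < √k := Real.sqrt_pos.2 hk
  have hn0 : 0 < √n := Real.sqrt_pos.2 hn
  have h1 : (√k - √(k - D)) * (√k + √(k - D)) = D := by
    have h2 := Real.mul_self_sqrt hk.le
    have h3 := Real.mul_self_sqrt (sub_nonneg.2 hDk)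
    linear_combination h2 - h3
  have h2 : √(k - D) ≤ √k := Real.sqrt_le_sqrt (by linarith)
  have h3 : (√k - √(k - D)) * (√k + √(k - D)) ≤ (√k - √(k - D)) * (2 * √k) :=
    mul_le_mul_of_nonneg_left (by linarith) (by linarith)
  rw [h1] at h3
  rw [div_le_div_iff₀ (by positivity) hn0]
  have h4 := mul_le_mul_of_nonneg_right h3 hn0.le
  linarith

theorem query_cost_le {n k R B l Δ Δ' : ℝ} (hn : 0 < n) (hk : 0 < k) (hΔ : 0 < Δ) (hΔΔ' : Δ ≤ Δ')
    (hR : 0 ≤ R) (hB : 1 ≤ B) (hl : 0 ≤ l) (hRle : R ≤ 3 * (n / k) * l)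
    (hBle : B ≤ 360 * l * (√k * √n / Δ')) :
    R * (2 * (2 * B + 1)) ≤ 6480 * (n ^ (3 / 2 : ℝ) / (Δ * √k)) * l ^ 2 := by
  have hk0 : 0 < √k := Real.sqrt_pos.2 hk
  have hn0 : 0 < √n := Real.sqrt_pos.2 hn
  have hpow : n ^ (3 / 2 : ℝ) = n * √n := by
    rw [show (3 / 2 : ℝ) = 1 + 1 / 2 by norm_num, Real.rpow_add hn, Real.rpow_one,
      ← Real.sqrt_eq_rpow]
  have h1 : √k * √n / Δ' ≤ √k * √n / Δ := div_le_div_of_nonneg_left (by positivity) hΔ hΔΔ'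
  have h2 : B ≤ 360 * l * (√k * √n / Δ) :=
    hBle.trans (mul_le_mul_of_nonneg_left h1 (by positivity))
  have h3 : n / k * √k = n / √k := by
    rw [div_mul_eq_mul_div, div_eq_div_iff hk.ne' hk0.ne', mul_assoc, Real.mul_self_sqrt hk.le]
  calc R * (2 * (2 * B + 1)) ≤ R * (6 * B) := mul_le_mul_of_nonneg_left (by linarith) hR
    _ ≤ (3 * (n / k) * l) * (6 * (360 * l * (√k * √n / Δ))) :=
        mul_le_mul hRle (by linarith) (by linarith) (by positivity)
    _ = 6480 * ((n / k * √k) * √n / Δ) * l ^ 2 := by ring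
    _ = _ := by rw [hpow, h3]; congr 2; field_simp

/-- The parameters of the algorithm can be chosen within the claimed bounds. -/
theorem exists_parameters {n k : ℕ} {Δ Δ' δ g : ℝ} (hk : 1 ≤ k) (hkn : k ≤ n)
    (hΔ : 0 < Δ) (hΔ' : Δ' = max Δ 1) (hΔk : Δ ≤ k) (hδ : 0 < δ) (hδ2 : δ < 1 / 2)
    (hg : g = (√k - √(k - Δ')) / √n) :
    0 < g ∧ ∃ b c N r R : ℕ, 4 ≤ g * N ∧ 0 < N ∧ (r + 1) * N ≤ 2 ^ b ∧ 2 * R < 2 ^ c ∧ 1 ≤ r ∧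
      2 * R ≤ δ * 2 ^ r ∧ n / k * Real.log (1 / δ) ≤ R ∧
      ((R * (2 * (2 * 2 ^ b + 1)) : ℕ) : ℝ) ≤
        6480 * ((n : ℝ) ^ (3 / 2 : ℝ) / (Δ * √k)) * Real.log (n / (δ * k)) ^ 2 ∧
      (2 : ℝ) ^ b ≤ 360 * Real.log (n / (δ * k)) * n ∧
      (2 : ℝ) ^ c ≤ 18 * Real.log (n / (δ * k)) * n := by
  have hk1 : (1 : ℝ) ≤ k := by exact_mod_cast hk
  have hk' : (0 : ℝ) < k := by linarith
  have hkn' : (k : ℝ) ≤ n := by exact_mod_cast hkn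
  have hn' : (0 : ℝ) < n := by linarith
  have hΔ'1 : 1 ≤ Δ' := by rw [hΔ']; exact le_max_right _ _
  have hΔΔ' : Δ ≤ Δ' := by rw [hΔ']; exact le_max_left _ _
  have hΔ'k : Δ' ≤ k := by rw [hΔ']; exact max_le hΔk hk1
  have hΔ'0 : 0 < Δ' := by linarith
  have hq1 : 1 ≤ (n : ℝ) / k := (one_le_div hk').2 hkn'
  have hqn : (n : ℝ) / k ≤ n := div_le_self hn'.le hk1
  have hl1 : Real.log (1 / δ) ≤ Real.log (n / (δ * k)) := by
    apply Real.log_le_log (by positivity)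
    rw [div_mul_eq_div_div_swap]
    exact div_le_div_of_nonneg_right hq1 hδ.le
  have hl2 : Real.log 2 ≤ Real.log (1 / δ) := by
    apply Real.log_le_log (by norm_num)
    rw [le_div_iff₀ hδ]; linarith
  have hlog2 := Real.log_two_gt_d9
  have hexp : Real.exp (Real.log (n / (δ * k))) = n / k / δ := by
    rw [Real.exp_log (by positivity), div_mul_eq_div_div_swap]
  generalize Real.log (n / (δ * k)) = l at *
  have hl0 : 1 ≤ 2 * l := by linarith
  have hk0 : 0 < √(k : ℝ) := Real.sqrt_pos.2 hk'
  have hn0 : 0 < √(n : ℝ) := Real.sqrt_pos.2 hn'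
  have hgl : Δ' / (2 * (√(k : ℝ) * √n)) ≤ g := by
    rw [hg]; exact div_le_sqrt_gap hk' hn' hΔ'0.le hΔ'k
  refine ⟨lt_of_lt_of_le (by positivity) hgl, ?_⟩
  have hsk : √(k : ℝ) ≤ √n := Real.sqrt_le_sqrt hkn'
  have hle1 : Δ' ≤ √(k : ℝ) * √n := by
    have h1 := mul_le_mul_of_nonneg_left hsk hk0.le
    rw [Real.mul_self_sqrt hk'.le] at h1
    linarith
  -- Here `Δ' ≥ 1` matters: with an arbitrarily small gap the clock would not fit in the qubit
  -- bound.
  have hle2 : √(k : ℝ) * √n / Δ' ≤ n := by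
    have h1 := mul_le_mul_of_nonneg_right hsk hn0.le
    rw [Real.mul_self_sqrt hn'.le] at h1
    exact (div_le_self (by positivity) hΔ'1).trans h1
  obtain ⟨N, hgN, hN0, hNle⟩ := exists_boxLength hΔ'0 hle1 hgl
  obtain ⟨R, hR1, hRge, hRle⟩ := exists_rounds hq1 (by linarith) hl1 hl0
  obtain ⟨r, hr1, hrR, hrle⟩ := exists_order hR1 hδ hδ2 (hl2.trans hl1) hexp hRle
  have hR1' : (1 : ℝ) ≤ R := by exact_mod_cast hR1
  have hMle : (2 : ℝ) ^ Nat.clog 2 ((r + 1) * N) ≤ 360 * l * (√(k : ℝ) * √n / Δ') := by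
    have h1 : (2 : ℝ) ^ Nat.clog 2 ((r + 1) * N) ≤ 2 * ((r + 1) * N) := by
      exact_mod_cast two_pow_clog_le (Nat.mul_pos (Nat.succ_pos r) hN0)
    have h2 : ((r : ℝ) + 1) * N ≤ (20 * l) * (9 * (√(k : ℝ) * √n) / Δ') :=
      mul_le_mul hrle hNle (Nat.cast_nonneg N) (by linarith)
    calc _ ≤ _ := h1
      _ ≤ 2 * ((20 * l) * (9 * (√(k : ℝ) * √n) / Δ')) := by linarith
      _ = _ := by ring
  have hcle : (2 : ℝ) ^ Nat.clog 2 (2 * R + 1) ≤ 18 * l * n := by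
    have h1 : (2 : ℝ) ^ Nat.clog 2 (2 * R + 1) ≤ 2 * (2 * R + 1) := by
      exact_mod_cast two_pow_clog_le (by omega : 1 ≤ 2 * R + 1)
    have h2 : l * (n / k) ≤ l * n := mul_le_mul_of_nonneg_left hqn (by linarith)
    calc _ ≤ _ := h1
      _ ≤ 6 * (3 * (n / k) * l) := by linarith
      _ ≤ _ := by linarith
  refine ⟨Nat.clog 2 ((r + 1) * N), Nat.clog 2 (2 * R + 1), N, r, R, hgN, hN0,
    Nat.le_pow_clog (by norm_num) _, Nat.le_pow_clog (by norm_num) (2 * R + 1), hr1, hrR, hRge, ?_,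
    hMle.trans (mul_le_mul_of_nonneg_left hle2 (by linarith)), hcle⟩
  push_cast
  exact query_cost_le hn' hk' hΔ hΔΔ' (by linarith) (one_le_pow₀ (by norm_num)) (by linarith)
    hRle hMle

/-! ### The degenerate case and the conclusion -/

theorem exists_trivialAlgorithm (n m : ℕ) : ∃ alg : QueryAlgorithm n m, alg.numQueries = 0 ∧
    alg.numQubits = Nat.clog 2 n + Nat.clog 2 m ∧ ∀ A, alg.acceptProb A = 1 := by
  obtain ⟨alg, h1, h2, h3⟩ := (QueryImpl.const (O := oracleIso (n := n) (m := m) 0)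
    1).exists_queryAlgorithm Finset.univ
  refine ⟨alg, h1, h2, fun A => ?_⟩
  rw [h3, ← EuclideanSpace.norm_sq_eq]
  simp

theorem mainTheorem5 :
    ∃ (C : ℝ) (c : ℕ), 0 < C ∧ ∀ (n m k : ℕ) (Δ δ : ℝ),
      1 ≤ m → 1 ≤ k → k ≤ n → 0 < Δ → Δ ≤ k → 0 < δ → δ < 1 / 2 →
      ∃ alg : QueryAlgorithm n m,
        SolvesGappedKDistinctness alg k Δ δ ∧
        (alg.numQueries : ℝ) ≤
          C * ((n : ℝ) ^ (3 / 2 : ℝ) / (Δ * √(k : ℝ))) * Real.log (n / (δ * k)) ^ c ∧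
        (alg.numQubits : ℝ) ≤
          C * ((Real.log m + Real.log n) * Real.log (n / (δ * k))) := by
  refine ⟨6480, 2, by norm_num, fun n m k Δ δ hm hk hkn hΔ hΔk hδ hδ2 => ?_⟩
  have hk' : (1 : ℝ) ≤ k := by exact_mod_cast hk
  have hkn' : (k : ℝ) ≤ n := by exact_mod_cast hkn
  have hl : Real.log 2 ≤ Real.log (n / (δ * k)) := by
    apply Real.log_le_log (by norm_num)
    rw [le_div_iff₀ (by positivity)]
    nlinarith
  have hlog2 := Real.log_two_gt_d9
  set l := Real.log (n / (δ * k))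
  have hl0 : 0 < l := by linarith
  have hlm : 0 ≤ Real.log m := Real.log_natCast_nonneg m
  have hln : 0 ≤ Real.log n := Real.log_natCast_nonneg n
  have hcm := clog_le_log hm
  have hcn := clog_le_log (hk.trans hkn)
  have hlm2 : Real.log m ≤ 2 * (Real.log m * l) := by nlinarith
  have hln2 : Real.log n ≤ 2 * (Real.log n * l) := by nlinarith
  -- For `n = 1` the bound contains no `log n` to pay for work qubits. Then `k = 1`, every array is
  -- a yes-instance, and always accepting is correct.
  rcases (hk.trans hkn).eq_or_lt with hn1 | hn2
  · obtain ⟨alg, h1, h2, h3⟩ := exists_trivialAlgorithm n m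
    obtain rfl : k = 1 := by omega
    refine ⟨alg, fun A => ⟨fun _ => by rw [h3]; linarith, fun hA => ?_⟩, ?_, ?_⟩
    · have i : Fin n := ⟨0, by omega⟩
      have h4 : (1 : ℝ) ≤ ((Finset.univ.filter fun j => A j = A i).card : ℝ) := by
        exact_mod_cast Finset.card_pos.2 ⟨i, by simp⟩
      have h5 := hA (A i)
      push_cast at h5
      linarith
    · rw [h1, Nat.cast_zero]; positivity
    · rw [h2]; push_cast; nlinarith [mul_nonneg hlm hl0.le, mul_nonneg hln hl0.le]
  · obtain ⟨hg0, b, c, N, r, R, hgN, hN, hM, hcR, hr, hrR, hRδ, hq, hb, hc⟩ :=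
      exists_parameters hk hkn hΔ rfl hΔk hδ hδ2 rfl
    obtain ⟨alg, h1, h2, h3⟩ := exists_solves (m := m) (hk.trans hkn) hk hΔ rfl hΔk hδ rfl hg0 hgN
      hN hM hcR hr hrR hRδ
    refine ⟨alg, h1, by rw [h2]; exact hq, ?_⟩
    have hn0 : (0 : ℝ) < n := by linarith
    have hlogn : Real.log 2 ≤ Real.log n :=
      Real.log_le_log (by norm_num) (by exact_mod_cast hn2)
    have hb1 := le_two_mul_log hb
    have hc1 := le_two_mul_log hc
    have hb2 := log_le_of_le_mul (j := 9) (by positivity : 0 < 360 * l * n) (by norm_num)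
      (by norm_num) hl0 hn0 le_rfl
    have hc2 := log_le_of_le_mul (j := 5) (by positivity : 0 < 18 * l * n) (by norm_num)
      (by norm_num) hl0 hn0 le_rfl
    push_cast at hb2 hc2
    -- Clock and counter take `O(1 + l + log n)` qubits; since `log n` and `l` are at least `log 2`,
    -- this is absorbed into `log n * l`.
    have e1 : 1 ≤ 4 * (Real.log n * l) := by nlinarith
    have e2 : l ≤ 2 * (Real.log n * l) := by nlinarith
    have e3 : 0 ≤ Real.log m * l := mul_nonneg hlm hl0.le
    rw [h3]
    push_cast
    linarith
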